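/- For a Noetherian local ring $A$, the Hochster--Huneke graph $\Gamma_A$ is the simple graph whose vertices are the minimal primes $\mathfrak{p}$ of $A$ with $\dim(A/\mathfrak{p})=\dim(A)$, and in which two distinct vertices $\mathfrak{p}$ and $\mathfrak{q}$ are joined by an edge if and only if the ideal $\mathfrak{p}+\mathfrak{q}$ has height one. Let $(R,\mathfrak{m})$ be a complete Noetherian local domain (of arbitrary characteristic and residue characteristic), and let $x\in\mathfrak{m}$ be nonzero. Then the Hochster--Huneke graph $\Gamma_{R/xR}$ is connected. -/

import Mathlib

/-- The vertices of the Hochster-Huneke graph: the minimal primes `p` of `R` with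
`dim (R / p) = dim R`. -/
def HochsterHunekeVertex (R : Type*) [CommRing R] : Type _ :=
  {p : Ideal R // p ∈ minimalPrimes R ∧ ringKrullDim (R ⧸ p) = ringKrullDim R}

/-- The Hochster-Huneke graph of a (Noetherian local) ring `R`: two distinct vertices `p` and `q`
are joined by an edge precisely if the ideal `p + q` has height one. -/
def hochsterHunekeGraph (R : Type*) [CommRing R] : SimpleGraph (HochsterHunekeVertex R) where
  Adj p q := p ≠ q ∧ (p.1 + q.1).height = 1
  symm := ⟨fun p q h => ⟨h.1.symm, by rw [add_comm]; exact h.2⟩⟩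
  loopless := ⟨fun _ h => h.1 rfl⟩

/-! Let d = dim R. As in Cohen's structure theory, R is finite over a Noetherian local subring A
whose maximal ideal is generated by d = dim A elements. Such an A is a domain of depth d. The
A-linear double dual S of R inside Frac R is again a ring, finite over R, and fits into an exact
sequence 0 → S → A^n → A^t.

Every minimal prime of x has dimension d - 1, so the vertices are all the minimal primes of R/xR. If
the graph were disconnected, let I and J be the intersections of the primes on the two sides. Then
IJ is nilpotent modulo x. A prime containing I + J contains two nonadjacent vertices, so its
dimension is at most d - 3. Hence (I + J) ∩ A contains an A-regular sequence a_0, a_1, a_2.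

On the open set U where some a_k is invertible, the loci of I and J in x = 0 are disjoint, so there
is a function equal to 1 on the first and 0 on the second, defined modulo any prescribed power of x.
The obstruction to lifting it to S is a class in H^1(U, S). Because A has three regular elements and
S is a second syzygy, this class is recorded by a vector η in A^t. The vectors whose class is killed
by x^m form an increasing chain in the Noetherian module A^t. Once x^(m+1)-torsion is x^m-torsion, a
function given modulo x^(m+1) lifts to f in S after restriction to x = 0 (`exists_smul_eq_sub`,
`exists_separating_element`). Then f lies in a prime over one component and 1 - f in a prime over
another. This is impossible, since S is a finite domain over a complete local ring and hence local
(`isUnit_or_isUnit_one_sub_of_finite`). The contradiction is assembled in `false_of_separated`. -/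

/-! ### The Eakin–Nagata theorem. -/

/-- A finite torsion-free extension of domains admits a nonzero linear functional to the base. -/
theorem exists_linearMap_ne_zero_of_finite (A R : Type*) [CommRing A] [IsDomain A] [CommRing R]
    [IsDomain R] [Algebra A R] [FaithfulSMul A R] [Module.Finite A R] :
    ∃ τ : R →ₗ[A] A, τ ≠ 0 := by
  classical
  let K := FractionRing A
  let L := FractionRing R
  let _ : Algebra K L := FractionRing.liftAlgebra A L
  have : IsScalarTower A K L := FractionRing.isScalarTower_liftAlgebra A L
  obtain ⟨τ, hτ⟩ : ∃ τ : L →ₗ[K] K, τ 1 ≠ 0 := by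
    by_contra! h
    exact one_ne_zero ((Module.forall_dual_apply_eq_zero_iff K (1 : L)).mp h)
  obtain ⟨s, hs⟩ := (Module.Finite.fg_top : (⊤ : Submodule A R).FG)
  obtain ⟨⟨b, hb⟩, hbs⟩ := IsLocalization.exist_integer_multiples (nonZeroDivisors A) s
    (fun r : R => τ (algebraMap R L r))
  let τ' : R →ₗ[A] K := b • (τ.restrictScalars A ∘ₗ (IsScalarTower.toAlgHom A R L).toLinearMap)
  have hτ' : ∀ r, τ' r = b • τ (algebraMap R L r) := fun r => rfl
  have hr : ∀ r : R, τ' r ∈ LinearMap.range (Algebra.linearMap A K) := by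
    intro r
    have : r ∈ Submodule.span A (s : Set R) := hs ▸ Submodule.mem_top
    induction this using Submodule.span_induction with
    | mem x hx => obtain ⟨a, ha⟩ := hbs x hx; exact ⟨a, by rw [hτ']; exact ha⟩
    | zero => simp
    | add x y _ _ hx hy => rw [map_add]; exact Submodule.add_mem _ hx hy
    | smul a x _ hx => rw [map_smul]; exact Submodule.smul_mem _ _ hx
  have hinj : Function.Injective (Algebra.linearMap A K) := IsFractionRing.injective A K
  let e := LinearEquiv.ofInjective (Algebra.linearMap A K) hinj
  refine ⟨e.symm.toLinearMap ∘ₗ τ'.codRestrict _ hr, fun h => hτ ?_⟩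
  have h1 := LinearMap.congr_fun h 1
  simp only [LinearMap.comp_apply, LinearMap.zero_apply, LinearEquiv.coe_coe,
    LinearEquiv.map_eq_zero_iff] at h1
  have h2 : τ' 1 = 0 := congrArg Subtype.val h1
  rw [hτ', map_one, Algebra.smul_def, mul_eq_zero] at h2
  refine h2.resolve_left ?_
  rw [map_eq_zero_iff _ (IsFractionRing.injective A K)]
  exact nonZeroDivisors.ne_zero hb

/-- If `A ⊆ R` is a finite extension of domains such that `R ⧸ J` is a Noetherian `A`-module for
every nonzero ideal `J` of `R`, then `A` is Noetherian. -/
theorem isNoetherianRing_of_forall_isNoetherian_quotient (A R : Type*) [CommRing A] [IsDomain A]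
    [CommRing R] [IsDomain R] [Algebra A R] [FaithfulSMul A R] [Module.Finite A R]
    (h : ∀ J : Ideal R, J ≠ ⊥ → IsNoetherian A (R ⧸ J)) : IsNoetherianRing A := by
  obtain ⟨τ, hτ⟩ := exists_linearMap_ne_zero_of_finite A R
  obtain ⟨r, hr⟩ : ∃ r, τ r ≠ 0 := by
    by_contra! h; exact hτ (LinearMap.ext h)
  rw [isNoetherianRing_iff_ideal_fg]
  intro I
  by_cases hI : I = ⊥
  · rw [hI]; exact Submodule.fg_bot
  obtain ⟨a, haI, ha⟩ := Submodule.exists_mem_ne_zero_of_ne_bot hI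
  set c := τ r
  have hca : c * a ≠ 0 := mul_ne_zero hr ha
  let J : Ideal R := Ideal.span {algebraMap A R (c * a)}
  have hJ : J ≠ ⊥ := by
    rw [Ne, Ideal.span_singleton_eq_bot, map_eq_zero_iff _ (FaithfulSMul.algebraMap_injective A R)]
    exact hca
  have := h J hJ
  let C : Ideal A := LinearMap.range τ
  let D : Ideal A := Ideal.span {c * a} * C
  have hDC : D ≤ C := Ideal.mul_le_right
  have hCfg : C.FG := by
    have := Module.Finite.range τ
    exact Module.Finite.iff_fg.mp this
  have hDfg : D.FG := Submodule.FG.mul ⟨{c * a}, by simp⟩ hCfg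
  -- `τ` maps caR into D = caC, so C/D is a quotient of R/caR and therefore Noetherian. Since D ⊆ cI
  -- ⊆ C and D is finitely generated, so is cI, which is isomorphic to I.
  have hnoeth : IsNoetherian A (C.restrictScalars A ⧸ (Submodule.comap C.subtype D)) := by
    let g : R →ₗ[A] (C.restrictScalars A ⧸ (Submodule.comap C.subtype D)) :=
      (Submodule.mkQ _) ∘ₗ τ.rangeRestrict
    have hg : ∀ x ∈ J.restrictScalars A, g x = 0 := by
      intro x hx
      obtain ⟨y, rfl⟩ := Ideal.mem_span_singleton'.mp hx
      have : g (y * algebraMap A R (c * a)) = Submodule.Quotient.mk (τ.rangeRestrict (y * algebraMap A R (c * a))) := rfl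
      rw [this, Submodule.Quotient.mk_eq_zero, Submodule.mem_comap]
      change τ (y * algebraMap A R (c * a)) ∈ D
      rw [mul_comm, ← Algebra.smul_def, map_smul]
      exact Ideal.mul_mem_mul (Ideal.mem_span_singleton_self _) ⟨y, rfl⟩
    let g' : (R ⧸ J) →ₗ[A] _ := Submodule.liftQ (J.restrictScalars A) g hg
    refine isNoetherian_of_surjective g' (LinearMap.range_eq_top.mpr ?_)
    intro z
    obtain ⟨⟨z, y, rfl⟩, rfl⟩ := Submodule.Quotient.mk_surjective _ z
    exact ⟨Submodule.Quotient.mk y, rfl⟩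
  have hDI : D ≤ Ideal.span {c} * I := by
    rw [Ideal.mul_le]
    rintro u hu v -
    obtain ⟨w, rfl⟩ := Ideal.mem_span_singleton'.mp hu
    rw [show w * (c * a) * v = c * (w * v * a) by ring]
    exact Ideal.mul_mem_mul (Ideal.mem_span_singleton_self _) (I.mul_mem_left _ haI)
  have hcC : Ideal.span {c} * I ≤ C := Ideal.mul_le_left.trans
    ((Ideal.span_singleton_le_iff_mem _).mpr ⟨r, rfl⟩)
  have hfg : (Ideal.span {c} * I).FG := by
    let f : C →ₗ[A] (C.restrictScalars A ⧸ (Submodule.comap C.subtype D)) := Submodule.mkQ _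
    have h1 : (Submodule.comap C.subtype (Ideal.span {c} * I)).FG := by
      refine Submodule.fg_of_fg_map_of_fg_inf_ker f (IsNoetherian.noetherian _) ?_
      have : Submodule.comap C.subtype (Ideal.span {c} * I) ⊓ LinearMap.ker f =
          Submodule.comap C.subtype D := by
        rw [Submodule.ker_mkQ]
        exact inf_eq_right.mpr (Submodule.comap_mono hDI)
      rw [this]
      refine (Submodule.fg_map_iff _ C.injective_subtype).mp ?_
      rwa [Submodule.map_comap_subtype, inf_eq_right.mpr hDC]
    have h2 := h1.map C.subtype
    rwa [Submodule.map_comap_subtype, inf_eq_right.mpr hcC] at h2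
  have hmap : Submodule.map (LinearMap.mulLeft A c) I = Ideal.span {c} * I := by
    ext z
    simp only [Submodule.mem_map, Ideal.mem_span_singleton_mul]
    rfl
  rw [← hmap] at hfg
  exact (Submodule.fg_map_iff (LinearMap.mulLeft A c) (mul_right_injective₀ hr)).mp hfg

/-- A form of the **Eakin–Nagata theorem**. -/
theorem isNoetherian_of_finite_of_isNoetherianRing (A R : Type*) [CommRing A] [CommRing R]
    [Algebra A R] [Module.Finite A R] [IsNoetherianRing R] : IsNoetherian A R := by
  have key : ∀ J : Ideal R, IsNoetherian A (R ⧸ J) := by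
    intro J
    induction J using WellFoundedGT.induction with
    | ind J ih =>
    by_cases hJ : J = ⊤
    · have : Subsingleton (R ⧸ J) := Ideal.Quotient.subsingleton_iff.mpr hJ
      infer_instance
    by_cases hp : J.IsPrime
    -- For prime J the previous theorem applies to B ⊆ R/J: proper quotients of R/J are Noetherian
    -- by induction.
    · let B := A ⧸ J.comap (algebraMap A R)
      have : (J.comap (algebraMap A R)).IsPrime := inferInstance
      have : FaithfulSMul B (R ⧸ J) := by
        rw [faithfulSMul_iff_algebraMap_injective]
        exact Ideal.algebraMap_quotient_injective
      have hfin : Module.Finite B (R ⧸ J) := Module.Finite.of_restrictScalars_finite A _ _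
      have hB : IsNoetherianRing B := by
        refine isNoetherianRing_of_forall_isNoetherian_quotient B (R ⧸ J) fun I hI => ?_
        have hlt : J < I.comap (Ideal.Quotient.mk J) := by
          have h1 : J = (⊥ : Ideal (R ⧸ J)).comap (Ideal.Quotient.mk J) := by
            rw [← RingHom.ker_eq_comap_bot, Ideal.mk_ker]
          conv_lhs => rw [h1]
          exact lt_of_le_of_ne (Ideal.comap_mono bot_le) fun h => hI
            (Ideal.comap_injective_of_surjective _ Ideal.Quotient.mk_surjective h).symm
        have := ih _ hlt
        let g : (R ⧸ I.comap (Ideal.Quotient.mk J)) →+* ((R ⧸ J) ⧸ I) :=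
          Ideal.quotientMap I (Ideal.Quotient.mk J) le_rfl
        let g' : (R ⧸ I.comap (Ideal.Quotient.mk J)) →ₗ[A] ((R ⧸ J) ⧸ I) :=
          { g with
            map_smul' := fun a x => Submodule.Quotient.induction_on _ x fun _ => rfl }
        have hn : IsNoetherian A ((R ⧸ J) ⧸ I) := by
          refine isNoetherian_of_surjective g' (LinearMap.range_eq_top.mpr ?_)
          exact Ideal.quotientMap_surjective (H := le_rfl) Ideal.Quotient.mk_surjective
        exact isNoetherian_of_tower A hn
      have hB' : IsNoetherian B (R ⧸ J) := isNoetherian_of_isNoetherianRing_of_finite B _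
      rw [isNoetherian_iff'] at hB' ⊢
      let e : Submodule A (R ⧸ J) ≃o Submodule B (R ⧸ J) :=
        (Submodule.orderIsoOfAlgebraMapSurjective (R := A) (S := B) (M := R ⧸ J)
          Ideal.Quotient.mk_surjective).symm
      exact e.toOrderEmbedding.wellFoundedGT
    · obtain ⟨a, b, hab, ha, hb⟩ : ∃ a b, a * b ∈ J ∧ a ∉ J ∧ b ∉ J := by
        rw [Ideal.isPrime_iff] at hp
        push Not at hp
        obtain ⟨a, b, h1, h2, h3⟩ := hp hJ
        exact ⟨a, b, h1, h2, h3⟩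
      -- For J not prime, R/J is caught in the exact sequence R/(J : a) → R/J → R/(J + (a)), whose
      -- outer ideals are strictly larger than J.
      let I : Ideal R := Submodule.comap (LinearMap.mulLeft R a) J
      have hI : J < I := lt_of_le_of_ne (fun x hx => J.mul_mem_left a hx) fun h => hb (by
        rw [h]; exact hab)
      let I' : Ideal R := J ⊔ Ideal.span {a}
      have hI' : J < I' := lt_of_le_of_ne le_sup_left fun h => ha (by
        rw [h]; exact (le_sup_right : _ ≤ I') (Ideal.mem_span_singleton_self a))
      have h1 := ih I hI
      have h2 := ih I' hI'
      let f : (R ⧸ I) →ₗ[R] (R ⧸ J) := Submodule.mapQ I J (LinearMap.mulLeft R a) le_rfl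
      let g : (R ⧸ J) →ₗ[R] (R ⧸ I') := Submodule.factor hI'.le
      refine isNoetherian_of_range_eq_ker (f.restrictScalars A) (g.restrictScalars A) ?_
      ext z
      obtain ⟨z, rfl⟩ := Ideal.Quotient.mk_surjective z
      constructor
      · rintro ⟨y, hy⟩
        obtain ⟨y, rfl⟩ := Ideal.Quotient.mk_surjective y
        have hy : Ideal.Quotient.mk J (a * y) = Ideal.Quotient.mk J z := hy
        change Ideal.Quotient.mk I' z = 0
        rw [Ideal.Quotient.eq] at hy
        rw [Ideal.Quotient.eq_zero_iff_mem]
        have h3 : a * y ∈ I' := I'.mul_mem_right _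
          ((le_sup_right : _ ≤ I') (Ideal.mem_span_singleton_self a))
        have := I'.sub_mem h3 ((le_sup_left : J ≤ I') hy)
        rwa [sub_sub_cancel] at this
      · intro hz
        have hz : Ideal.Quotient.mk I' z = 0 := hz
        rw [Ideal.Quotient.eq_zero_iff_mem, Submodule.mem_sup] at hz
        obtain ⟨u, hu, v, hv, rfl⟩ := hz
        obtain ⟨w, rfl⟩ := Ideal.mem_span_singleton'.mp hv
        refine ⟨Ideal.Quotient.mk I w, ?_⟩
        change Ideal.Quotient.mk J (a * w) = _
        rw [Ideal.Quotient.eq, mul_comm]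
        rw [show w * a - (u + w * a) = -u by ring]
        exact J.neg_mem hu
  have := key ⊥
  refine isNoetherian_of_injective
    ((Ideal.Quotient.mkₐ A (⊥ : Ideal R)).toLinearMap) ?_
  exact (RingEquiv.quotientBot R).symm.injective

theorem isNoetherianRing_of_finite_of_isNoetherianRing (A R : Type*) [CommRing A] [CommRing R]
    [Algebra A R] [FaithfulSMul A R] [Module.Finite A R] [IsNoetherianRing R] :
    IsNoetherianRing A := by
  have := isNoetherian_of_finite_of_isNoetherianRing A R
  exact isNoetherian_of_injective (Algebra.linearMap A R) (FaithfulSMul.algebraMap_injective A R)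

/-! ### Coefficient fields of nilpotent thickenings. -/

open Polynomial in
/-- A square-zero thickening of a field of characteristic `p` has a coefficient field,
provided that `p = 0` in it. -/
theorem exists_coefficientField_of_sq_zero_of_charP {B k : Type*} [CommRing B] [Field k] (p : ℕ)
    [hp : Fact p.Prime] [CharP k p] (hpB : (p : B) = 0) (π : B →+* k)
    (hπ : Function.Surjective π) (hsq : ∀ u v, π u = 0 → π v = 0 → u * v = 0) :
    ∃ C : Subring B, (∀ c ∈ C, π c = 0 → c = 0) ∧ ∀ a, ∃ c ∈ C, π c = a := by
  have hchar : CharP B p := ⟨fun n => by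
    constructor
    · intro h
      have : (n : k) = 0 := by rw [← map_natCast π, h, map_zero]
      exact (CharP.cast_eq_zero_iff k p n).mp this
    · rintro ⟨m, rfl⟩
      rw [Nat.cast_mul, hpB, zero_mul]⟩
  let S : Set (Subring B) := {C | (∀ c ∈ C, π c = 0 → c = 0) ∧ ∀ b : B, b ^ p ∈ C}
  have h0 : (frobenius B p).range ∈ S := by
    refine ⟨?_, fun b => ⟨b, frobenius_def p b⟩⟩
    rintro _ ⟨b, rfl⟩ hb
    rw [frobenius_def, map_pow] at hb
    have hb0 := pow_eq_zero_iff hp.out.ne_zero |>.mp hb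
    rw [frobenius_def, ← Nat.sub_add_cancel hp.out.two_le, pow_add, pow_two, hsq b b hb0 hb0,
      mul_zero]
  obtain ⟨C, -, hC⟩ := zorn_le_nonempty₀ S (by
    intro c hcS hc y hy
    have hd : DirectedOn (· ≤ ·) c := hc.directedOn
    refine ⟨sSup c, ⟨?_, fun b => ?_⟩, fun z hz => le_sSup hz⟩
    · intro x hx hx0
      obtain ⟨s, hs, hxs⟩ := (Subring.mem_sSup_of_directedOn ⟨y, hy⟩ hd).mp hx
      exact (hcS hs).1 x hxs hx0
    · exact (Subring.mem_sSup_of_directedOn ⟨y, hy⟩ hd).mpr ⟨y, hy, (hcS hy).2 b⟩) _ h0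
  refine ⟨C, hC.prop.1, fun a => ?_⟩
  by_contra! ha
  obtain ⟨β, rfl⟩ := hπ a
  -- The image of C is a field because it contains all p-th powers: c⁻¹ = (c⁻¹)^p c^(p-1).
  let K : Subfield k :=
    { C.map π with
      inv_mem' := by
        rintro _ ⟨c, hc, rfl⟩
        obtain ⟨d, hd⟩ := hπ (π c)⁻¹
        refine ⟨d ^ p * c ^ (p - 1), C.mul_mem (hC.prop.2 d) (C.pow_mem hc _), ?_⟩
        by_cases hc0 : π c = 0
        · rw [map_mul, map_pow, hd, hc0, inv_zero, zero_pow hp.out.ne_zero, zero_mul]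
        · rw [map_mul, map_pow, hd, map_pow]
          obtain ⟨q, hq⟩ := Nat.exists_eq_succ_of_ne_zero hp.out.ne_zero
          rw [hq, Nat.succ_sub_one, pow_succ, mul_right_comm, ← mul_pow, inv_mul_cancel₀ hc0,
            one_pow, one_mul] }
  have hKmem : ∀ x, x ∈ K ↔ ∃ c ∈ C, π c = x := fun x => Iff.rfl
  let ρ : C →+* K := (π.comp C.subtype).codRestrict K fun c => ⟨c, c.2, rfl⟩
  let α : K := ⟨π β ^ p, β ^ p, hC.prop.2 β, map_pow π β p⟩
  have hirr : Irreducible (X ^ p - Polynomial.C α) := by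
    refine X_pow_sub_C_irreducible_of_prime hp.out fun b hb => ?_
    obtain ⟨c, hc, hcb⟩ := b.2
    refine ha c hc (hcb.trans ?_)
    have h1 : (b : k) ^ p = π β ^ p := congrArg Subtype.val hb
    exact frobenius_inj k p h1
  let f : C[X] := X ^ p - Polynomial.C ⟨β ^ p, hC.prop.2 β⟩
  have hf : f.Monic := monic_X_pow_sub_C _ hp.out.ne_zero
  let ev := Polynomial.eval₂RingHom C.subtype β
  have : Nontrivial C := ρ.domain_nontrivial
  have hCle : C ≤ ev.range := fun c hc => ⟨Polynomial.C ⟨c, hc⟩, by simp [ev]⟩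
  -- Adjoining β keeps the kernel trivial: X^p - β^p vanishes at β, so only remainders of degree
  -- below p matter, and irreducibility over K forces such a remainder to vanish if its value at π β
  -- is 0. This contradicts the maximality of C.
  have hmem : ev.range ∈ S := by
    refine ⟨?_, fun b => hCle (hC.prop.2 b)⟩
    rintro _ ⟨g, rfl⟩ hg
    have hevf : ev f = 0 := by simp [ev, f]
    have hred : ev g = ev (g %ₘ f) := by
      conv_lhs => rw [← modByMonic_add_div g f]
      rw [map_add, map_mul, hevf, zero_mul, add_zero]
    rw [hred] at hg ⊢
    have hzero : (g %ₘ f).map ρ = 0 := by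
      by_contra hne
      have hroot : aeval (π β) ((g %ₘ f).map ρ) = 0 := by
        rw [aeval_def, eval₂_map, ← hg]
        change _ = π (eval₂ C.subtype β _)
        rw [hom_eval₂]
        rfl
      have hmin : minpoly K (π β) = X ^ p - Polynomial.C α := by
        refine (minpoly.eq_of_irreducible_of_monic hirr ?_ (monic_X_pow_sub_C _ hp.out.ne_zero)).symm
        simp only [map_sub, map_pow, aeval_X, aeval_C]
        exact sub_self _
      have h1 := minpoly.degree_le_of_ne_zero K (π β) hne hroot
      rw [hmin, degree_X_pow_sub_C hp.out.pos] at h1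
      have h2 := (degree_map_le (f := ρ) (p := g %ₘ f)).trans_lt (degree_modByMonic_lt g hf)
      rw [degree_X_pow_sub_C hp.out.pos] at h2
      exact absurd h1 (not_le.mpr h2)
    have : g %ₘ f = 0 := by
      ext n
      have h1 : ρ ((g %ₘ f).coeff n) = 0 := by rw [← coeff_map, hzero, coeff_zero]
      exact hC.prop.1 _ ((g %ₘ f).coeff n).2 (congrArg Subtype.val h1)
    rw [this, map_zero]
  exact ha β (hC.le_of_ge hmem hCle ⟨X, by simp [ev]⟩) rfl

/-- A nilpotent thickening of a field of characteristic `p` has a coefficient field,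
provided that `p = 0` in it. -/
theorem exists_coefficientField_of_charP {k : Type*} [Field k] (p : ℕ)
    [hp : Fact p.Prime] [CharP k p] (n : ℕ) {B : Type*} [CommRing B] (hpB : (p : B) = 0)
    (π : B →+* k) (hπ : Function.Surjective π) (hn : RingHom.ker π ^ (n + 1) = ⊥) :
    ∃ C : Subring B, (∀ c ∈ C, π c = 0 → c = 0) ∧ ∀ a, ∃ c ∈ C, π c = a := by
  induction n generalizing B with
  | zero =>
    refine ⟨⊤, fun c _ hc => ?_, fun a => ?_⟩
    · rw [zero_add, pow_one] at hn
      have : c ∈ RingHom.ker π := hc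
      rwa [hn, Ideal.mem_bot] at this
    · obtain ⟨b, hb⟩ := hπ a
      exact ⟨b, trivial, hb⟩
  | succ n ih =>
    let V := RingHom.ker π
    let I := V ^ (n + 1)
    have hIV : I ≤ V := Ideal.pow_le_self (Nat.succ_ne_zero n)
    let π' : (B ⧸ I) →+* k := Ideal.Quotient.lift I π hIV
    have hker : RingHom.ker π' = V.map (Ideal.Quotient.mk I) := by
      rw [Ideal.ker_quotient_lift]
    obtain ⟨C₁, hC₁, hC₁'⟩ := ih (B := B ⧸ I) (by rw [← map_natCast (Ideal.Quotient.mk I), hpB,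
      map_zero]) π' (Ideal.Quotient.lift_surjective_of_surjective _ _ hπ) (by
        rw [hker, ← Ideal.map_pow, Ideal.map_quotient_self])
    let B' : Subring B := C₁.comap (Ideal.Quotient.mk I)
    let π'' : B' →+* k := π.comp B'.subtype
    have hkI : ∀ u : B', π'' u = 0 → (u : B) ∈ I := fun u hu =>
      Ideal.Quotient.eq_zero_iff_mem.mp (hC₁ _ u.2 hu)
    obtain ⟨C₂, hC₂, hC₂'⟩ := exists_coefficientField_of_sq_zero_of_charP (B := B') p
      (Subtype.ext (by simpa using hpB)) π'' (fun a => by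
        obtain ⟨c, hc, hca⟩ := hC₁' a
        obtain ⟨b, rfl⟩ := Ideal.Quotient.mk_surjective c
        exact ⟨⟨b, hc⟩, hca⟩) (fun u v hu hv => by
        have h1 : (u : B) * v ∈ I * V := Ideal.mul_mem_mul (hkI u hu) (hIV (hkI v hv))
        have h2 : I * V = ⊥ := by rw [← pow_succ]; exact hn
        rw [h2, Ideal.mem_bot] at h1
        exact Subtype.ext h1)
    refine ⟨C₂.map B'.subtype, ?_, fun a => ?_⟩
    · rintro _ ⟨c, hc, rfl⟩ h
      rw [hC₂ c hc h, map_zero]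
    · obtain ⟨c, hc, hca⟩ := hC₂' a
      exact ⟨c, ⟨c, hc, rfl⟩, hca⟩

/-- A nilpotent thickening of a field of characteristic zero has a coefficient field. -/
theorem exists_coefficientField_of_charZero {k : Type*} [Field k] [CharZero k] {B : Type*}
    [CommRing B] (π : B →+* k) (hπ : Function.Surjective π) (hn : IsNilpotent (RingHom.ker π)) :
    ∃ C : Subring B, (∀ c ∈ C, π c = 0 → c = 0) ∧ ∀ a, ∃ c ∈ C, π c = a := by
  have hunit : ∀ z : nonZeroDivisors ℤ, IsUnit (Int.castRingHom B z) := by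
    intro z
    rw [← IsNilpotent.isUnit_quotient_mk_iff hn]
    have : IsUnit (RingHom.quotientKerEquivOfSurjective hπ
        (Ideal.Quotient.mk (RingHom.ker π) (Int.castRingHom B z))) := by
      rw [RingHom.quotientKerEquivOfSurjective_apply_mk, isUnit_iff_ne_zero]
      simp
    exact (isUnit_map_iff _ _).mp this
  let _ : Algebra ℚ B := (IsLocalization.lift (M := nonZeroDivisors ℤ) (S := ℚ) hunit).toAlgebra
  obtain ⟨s, hs⟩ := exists_isTranscendenceBasis ℚ k
  have : Algebra.IsAlgebraic (IntermediateField.adjoin ℚ (Set.range ((↑) : s → k))) k :=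
    hs.isAlgebraic_field
  -- In characteristic zero k is separable over a purely transcendental extension of ℚ, so the
  -- identity of k lifts through the nilpotent kernel.
  have : Algebra.FormallySmooth ℚ k :=
    Algebra.FormallySmooth.of_algebraicIndependent_of_isSeparable hs.1
  have hQ : π.comp (algebraMap ℚ B) = algebraMap ℚ k := Subsingleton.elim _ _
  let g : B →ₐ[ℚ] k := { π with commutes' := fun r => RingHom.congr_fun hQ r }
  let σ := Algebra.FormallySmooth.liftOfSurjective (AlgHom.id ℚ k) g hπ hn
  have hσ : ∀ a, π (σ a) = a := fun a =>
    Algebra.FormallySmooth.liftOfSurjective_apply (AlgHom.id ℚ k) g hπ hn a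
  refine ⟨(σ : k →+* B).range, ?_, fun a => ⟨σ a, ⟨a, rfl⟩, hσ a⟩⟩
  rintro _ ⟨a, rfl⟩ h
  have h' : π (σ a) = 0 := h
  rw [hσ] at h'
  rw [h', map_zero]

/-- A nilpotent thickening `B` of a field `k` has a coefficient field, provided that the residue
characteristic vanishes in `B`. -/
theorem exists_coefficientField {k : Type*} [Field k] {B : Type*} [CommRing B]
    (hchar : ∀ n : ℕ, (n : k) = 0 → (n : B) = 0)
    (π : B →+* k) (hπ : Function.Surjective π) (hn : IsNilpotent (RingHom.ker π)) :
    ∃ C : Subring B, (∀ c ∈ C, π c = 0 → c = 0) ∧ ∀ a, ∃ c ∈ C, π c = a := by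
  obtain ⟨p, hp⟩ := CharP.exists k
  obtain ⟨n, hn'⟩ := hn
  rcases CharP.char_is_prime_or_zero k p with h | rfl
  · have : Fact p.Prime := ⟨h⟩
    refine exists_coefficientField_of_charP p n (hchar p (CharP.cast_eq_zero k p)) π hπ ?_
    rw [pow_succ, hn', Ideal.zero_eq_bot, Ideal.bot_mul]
  · have := CharP.charP_to_charZero k
    exact exists_coefficientField_of_charZero π hπ ⟨n, hn'⟩

/-! ### A subring with maximal ideal generated by parameters. -/

open IsLocalRing

theorem Ideal.mem_span_range_mul_iff {R ι : Type*} [CommRing R] [Fintype ι] (x : ι → R)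
    (I : Ideal R) (z : R) :
    z ∈ Ideal.span (Set.range x) * I ↔ ∃ a : ι → R, (∀ i, a i ∈ I) ∧ z = ∑ i, a i * x i := by
  classical
  constructor
  · intro hz
    induction hz using Submodule.mul_induction_on' with
    | mem_mul_mem u hu v hv =>
      obtain ⟨c, rfl⟩ := (Ideal.mem_span_range_iff_exists_fun).mp hu
      exact ⟨fun i => c i * v, fun i => I.mul_mem_left _ hv, by
        rw [Finset.sum_mul]; exact Finset.sum_congr rfl fun i _ => by ring⟩
    | add u _ v _ hu hv =>
      obtain ⟨a, ha, rfl⟩ := hu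
      obtain ⟨b, hb, rfl⟩ := hv
      exact ⟨a + b, fun i => I.add_mem (ha i) (hb i), by
        rw [← Finset.sum_add_distrib]; exact Finset.sum_congr rfl fun i _ => by
          rw [Pi.add_apply]; ring⟩
  · rintro ⟨a, ha, rfl⟩
    refine Ideal.sum_mem _ fun i _ => ?_
    rw [mul_comm (Ideal.span _)]
    exact Ideal.mul_mem_mul (ha i) (Ideal.subset_span (Set.mem_range_self i))

section

variable {R ι : Type*} [CommRing R] [IsLocalRing R] [Fintype ι]

/-- A subring of `R` containing the `n`-th power of the ideal `q` generated by the `x i` which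
modulo that power looks like a local ring with maximal ideal generated by the `x i` and with the
same residue field as `R`. -/
structure IsCoefficientSubring (x : ι → R) (n : ℕ) (C : Subring R) : Prop where
  pow_le : ∀ z ∈ Ideal.span (Set.range x) ^ n, z ∈ C
  gen_mem : ∀ i, x i ∈ C
  exists_sub_mem : ∀ c ∈ C, c ∈ maximalIdeal R → ∃ a : ι → R, (∀ i, a i ∈ C) ∧
    c - ∑ i, a i * x i ∈ Ideal.span (Set.range x) ^ n
  surj : ∀ r, ∃ c ∈ C, r - c ∈ maximalIdeal R

/-- The preimage of a coefficient field of R/q. In `hchar` the coefficients are natural numbers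
because these lie in every subring, so the same relation can be reused inside each later subring. -/
theorem exists_isCoefficientSubring_one (x : ι → R) (hx : ∀ i, x i ∈ maximalIdeal R) (e : ℕ)
    (he : maximalIdeal R ^ e ≤ Ideal.span (Set.range x))
    (hchar : ∀ n : ℕ, (n : ResidueField R) = 0 → ∃ a : ι → ℕ, (n : R) = ∑ i, (a i : R) * x i) :
    ∃ C, IsCoefficientSubring x 1 C := by
  set q := Ideal.span (Set.range x) with hq
  have hqm : q ≤ maximalIdeal R := by
    rw [hq, Ideal.span_le]; rintro _ ⟨i, rfl⟩; exact hx i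
  let π : R ⧸ q →+* ResidueField R := Ideal.Quotient.factor hqm
  have hπ : Function.Surjective π := Ideal.Quotient.factor_surjective hqm
  obtain ⟨D, hD, hD'⟩ := exists_coefficientField (B := R ⧸ q) (by
    intro n hn
    obtain ⟨a, ha⟩ := hchar n hn
    rw [← map_natCast (Ideal.Quotient.mk q), Ideal.Quotient.eq_zero_iff_mem, ha]
    exact Ideal.sum_mem _ fun i _ => q.mul_mem_left _ (Ideal.subset_span ⟨i, rfl⟩)) π hπ (by
    refine ⟨e, ?_⟩
    have : RingHom.ker π = (maximalIdeal R).map (Ideal.Quotient.mk q) :=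
      Ideal.Quotient.factor_ker hqm
    rw [this, ← Ideal.map_pow, Ideal.zero_eq_bot, ← le_bot_iff, ← Ideal.map_quotient_self q]
    exact Ideal.map_mono he)
  have hqD : ∀ z ∈ q, z ∈ D.comap (Ideal.Quotient.mk q) := fun z hz => by
    rw [Subring.mem_comap, Ideal.Quotient.eq_zero_iff_mem.mpr hz]; exact D.zero_mem
  refine ⟨D.comap (Ideal.Quotient.mk q), ⟨?_, ?_, ?_, ?_⟩⟩
  · rw [pow_one]; exact hqD
  · exact fun i => hqD _ (Ideal.subset_span ⟨i, rfl⟩)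
  · intro c hc hcm
    refine ⟨0, fun i => Subring.zero_mem _, ?_⟩
    have h0 : π (Ideal.Quotient.mk q c) = 0 := Ideal.Quotient.eq_zero_iff_mem.mpr hcm
    simpa using Ideal.Quotient.eq_zero_iff_mem.mp (hD _ hc h0)
  · intro r
    obtain ⟨c, hc, hcr⟩ := hD' (residue R r)
    obtain ⟨c, rfl⟩ := Ideal.Quotient.mk_surjective c
    exact ⟨c, hc, Ideal.Quotient.eq.mp hcr.symm⟩

/-- Modulo J = (x_i)C + q^(n+2), the non-units of C come from q^(n+1), so C/J is a square-zero
thickening of the residue field. C' is the preimage of a coefficient field of C/J; passing to it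
discards only elements of q^(n+1), up to elements of C'. -/
theorem IsCoefficientSubring.exists_succ (x : ι → R) (hx : ∀ i, x i ∈ maximalIdeal R)
    (hchar : ∀ n : ℕ, (n : ResidueField R) = 0 → ∃ a : ι → ℕ, (n : R) = ∑ i, (a i : R) * x i)
    {n : ℕ} {C : Subring R} (hC : IsCoefficientSubring x (n + 1) C) :
    ∃ C' ≤ C, IsCoefficientSubring x (n + 2) C' ∧
      ∀ c ∈ C, ∃ c' ∈ C', c - c' ∈ Ideal.span (Set.range x) ^ (n + 1) := by
  set q := Ideal.span (Set.range x) with hq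
  have hqm : q ≤ maximalIdeal R := by
    rw [hq, Ideal.span_le]; rintro _ ⟨i, rfl⟩; exact hx i
  let y : ι → C := fun i => ⟨x i, hC.gen_mem i⟩
  let J : Ideal C := Ideal.span (Set.range y) ⊔ (q ^ (n + 2)).comap C.subtype
  have hJ : ∀ c : C, c ∈ J ↔ ∃ a : ι → C, (c : R) - ∑ i, (a i : R) * x i ∈ q ^ (n + 2) := by
    intro c
    constructor
    · intro hc
      obtain ⟨u, hu, v, hv, rfl⟩ := Submodule.mem_sup.mp hc
      obtain ⟨a, rfl⟩ := Ideal.mem_span_range_iff_exists_fun.mp hu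
      refine ⟨a, ?_⟩
      have hv : (v : R) ∈ q ^ (n + 2) := hv
      convert hv
      simp [y]
    · rintro ⟨a, ha⟩
      refine Submodule.mem_sup.mpr ⟨∑ i, a i * y i, Ideal.mem_span_range_iff_exists_fun.mpr
        ⟨a, rfl⟩, c - ∑ i, a i * y i, ?_, by ring⟩
      change ((c - ∑ i, a i * y i : C) : R) ∈ q ^ (n + 2)
      simpa [y] using ha
  have hJm : ∀ c : C, c ∈ J → residue R c = 0 := by
    intro c hc
    obtain ⟨a, ha⟩ := (hJ c).mp hc
    rw [residue_eq_zero_iff]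
    have h1 : (c : R) - ∑ i, (a i : R) * x i ∈ maximalIdeal R :=
      hqm (Ideal.pow_le_self (by omega) ha)
    have h2 : ∑ i, (a i : R) * x i ∈ maximalIdeal R :=
      Ideal.sum_mem _ fun i _ => Ideal.mul_mem_left _ _ (hx i)
    simpa using Ideal.add_mem _ h1 h2
  let π : C ⧸ J →+* ResidueField R := Ideal.Quotient.lift J ((residue R).comp C.subtype) hJm
  have hmem : ∀ c : C, residue R c = 0 → ∃ v : C, (v : R) ∈ q ^ (n + 1) ∧ c - v ∈ J := by
    intro c hc
    obtain ⟨a, ha, hca⟩ := hC.exists_sub_mem c c.2 ((residue_eq_zero_iff _).mp hc)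
    refine ⟨⟨_, hC.pow_le _ hca⟩, hca, (hJ _).mpr ⟨fun i => ⟨a i, ha i⟩, ?_⟩⟩
    simp
  obtain ⟨D, hD, hD'⟩ := exists_coefficientField (B := C ⧸ J) (by
    intro m hm
    obtain ⟨a, ha⟩ := hchar m hm
    rw [← map_natCast (Ideal.Quotient.mk J), Ideal.Quotient.eq_zero_iff_mem, hJ]
    refine ⟨fun i => (a i : C), ?_⟩
    simp [ha]) π (by
    intro a
    obtain ⟨r, rfl⟩ := residue_surjective a
    obtain ⟨c, hc, hcr⟩ := hC.surj r
    exact ⟨Ideal.Quotient.mk J ⟨c, hc⟩, (Ideal.Quotient.eq.mpr hcr).symm⟩) (by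
    refine ⟨2, ?_⟩
    rw [Ideal.zero_eq_bot, pow_two, ← le_bot_iff, Ideal.mul_le]
    intro u hu v hv
    obtain ⟨u, rfl⟩ := Ideal.Quotient.mk_surjective u
    obtain ⟨v, rfl⟩ := Ideal.Quotient.mk_surjective v
    obtain ⟨u', hu', hu''⟩ := hmem u hu
    obtain ⟨v', hv', hv''⟩ := hmem v hv
    rw [Ideal.Quotient.eq.mpr hu'', Ideal.Quotient.eq.mpr hv'', ← map_mul, Ideal.mem_bot,
      Ideal.Quotient.eq_zero_iff_mem, hJ]
    refine ⟨0, ?_⟩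
    have h1 : (u' : R) * v' ∈ q ^ (n + 1 + (n + 1)) := by
      rw [pow_add]; exact Ideal.mul_mem_mul hu' hv'
    simpa using Ideal.pow_le_pow_right (by omega) h1)
  let C' : Subring R := (D.comap (Ideal.Quotient.mk J)).map C.subtype
  have hC'C : C' ≤ C := by rintro _ ⟨c, -, rfl⟩; exact c.2
  have hJC' : ∀ c : C, c ∈ J → (c : R) ∈ C' := fun c hc => ⟨c, by
    change Ideal.Quotient.mk J c ∈ D
    rw [Ideal.Quotient.eq_zero_iff_mem.mpr hc]; exact D.zero_mem, rfl⟩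
  have happrox : ∀ c ∈ C, ∃ c' ∈ C', c - c' ∈ q ^ (n + 1) := by
    intro c hc
    obtain ⟨d, hd, hdc⟩ := hD' (residue R c)
    obtain ⟨d, rfl⟩ := Ideal.Quotient.mk_surjective d
    have hdc : residue R (d : R) = residue R c := hdc
    obtain ⟨v, hv, hvJ⟩ := hmem (⟨c, hc⟩ - d) (by simp [hdc])
    refine ⟨d + ((⟨c, hc⟩ - d - v : C) : R), C'.add_mem ⟨d, hd, rfl⟩ (hJC' _ hvJ), ?_⟩
    convert hv using 1
    push_cast
    ring
  refine ⟨C', hC'C, ⟨?_, ?_, ?_, ?_⟩, happrox⟩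
  · intro z hz
    refine hJC' ⟨z, hC.pow_le z (Ideal.pow_le_pow_right (by omega) hz)⟩ ((hJ _).mpr ⟨0, ?_⟩)
    simpa using hz
  · exact fun i => hJC' (y i) (Ideal.mem_sup_left (Ideal.subset_span ⟨i, rfl⟩))
  · rintro _ ⟨c, hc, rfl⟩ hcm
    have h0 : Ideal.Quotient.mk J c = 0 := hD _ hc ((residue_eq_zero_iff _).mpr hcm)
    obtain ⟨a, ha⟩ := (hJ c).mp (Ideal.Quotient.eq_zero_iff_mem.mp h0)
    choose b hb hab using fun i => happrox (a i) (a i).2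
    refine ⟨b, hb, ?_⟩
    have h1 : ∑ i, ((a i : R) - b i) * x i ∈ q ^ (n + 2) := by
      refine Ideal.sum_mem _ fun i _ => ?_
      rw [pow_succ q (n + 1)]
      exact Ideal.mul_mem_mul (hab i) (Ideal.subset_span ⟨i, rfl⟩)
    have h2 := Ideal.add_mem _ ha h1
    simp only [sub_mul, Finset.sum_sub_distrib] at h2
    rw [Subring.subtype_apply]
    convert h2 using 1
    ring
  · intro r
    obtain ⟨c, hc, hcr⟩ := hC.surj r
    obtain ⟨c', hc', hcc⟩ := happrox c hc
    refine ⟨c', hc', ?_⟩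
    simpa using Ideal.add_mem _ hcr (hqm (Ideal.pow_le_self (by omega) hcc))

theorem exists_antitone_isCoefficientSubring (x : ι → R) (hx : ∀ i, x i ∈ maximalIdeal R) (e : ℕ)
    (he : maximalIdeal R ^ e ≤ Ideal.span (Set.range x))
    (hchar : ∀ n : ℕ, (n : ResidueField R) = 0 → ∃ a : ι → ℕ, (n : R) = ∑ i, (a i : R) * x i) :
    ∃ C : ℕ → Subring R, Antitone C ∧ (∀ n, IsCoefficientSubring x (n + 1) (C n)) ∧
      ∀ n, ∀ c ∈ C n, ∃ c' ∈ C (n + 1), c - c' ∈ Ideal.span (Set.range x) ^ (n + 1) := by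
  obtain ⟨C₀, hC₀⟩ := exists_isCoefficientSubring_one x hx e he hchar
  choose F hF using fun (n : ℕ) (C : {C // IsCoefficientSubring x (n + 1) C}) =>
    C.2.exists_succ x hx hchar
  let s : ∀ n : ℕ, {C // IsCoefficientSubring x (n + 1) C} := fun n =>
    Nat.rec ⟨C₀, hC₀⟩ (fun n C => ⟨F n C, (hF n C).2.1⟩) n
  exact ⟨fun n => (s n).1, antitone_nat_of_succ_le fun n => (hF n (s n)).1, fun n => (s n).2,
    fun n => (hF n (s n)).2.2⟩

theorem exists_limit_of_maximalIdeal_pow_le [IsAdicComplete (maximalIdeal R) R] {q : Ideal R}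
    (hqm : q ≤ maximalIdeal R) {e : ℕ} (he : maximalIdeal R ^ e ≤ q) (f : ℕ → R)
    (hf : ∀ n, f (n + 1) - f n ∈ q ^ n) : ∃ L, ∀ n, L - f n ∈ q ^ n := by
  have hq : ∀ m n, m ≤ n → f n - f m ∈ q ^ m := by
    intro m n hmn
    induction n, hmn using Nat.le_induction with
    | base => simp
    | succ n hmn ih => simpa using Ideal.add_mem _ (Ideal.pow_le_pow_right hmn (hf n)) ih
  obtain ⟨L, hL⟩ := IsPrecomplete.prec (I := maximalIdeal R) (M := R) inferInstance (f := f) (by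
    intro m n hmn
    rw [SModEq.sub_mem, smul_eq_mul, Ideal.mul_top, ← neg_mem_iff, neg_sub]
    exact Ideal.pow_right_mono hqm _ (hq m n hmn))
  refine ⟨L, fun n => ?_⟩
  -- The index e n + n is large enough both for m^(e n) ≤ q^n and for the Cauchy estimate from n
  -- onwards.
  have h1 := hL (e * n + n)
  rw [SModEq.sub_mem, smul_eq_mul, Ideal.mul_top, ← neg_mem_iff, neg_sub] at h1
  have h2 : L - f (e * n + n) ∈ q ^ n := by
    refine Ideal.pow_right_mono he n ?_
    rw [← pow_mul]
    exact Ideal.pow_le_pow_right (Nat.le_add_right _ _) h1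
  simpa using Ideal.add_mem _ h2 (hq n (e * n + n) (Nat.le_add_left _ _))

/-- If `R` is a complete local ring and the `x i` generate an ideal of definition containing the
residue characteristic suitably, then `R` is finite over some subring over which it is integral and
which is a Noetherian local ring with maximal ideal generated by the `x i`. -/
theorem exists_subring_finite_maximalIdeal_eq_span [IsNoetherianRing R]
    [IsAdicComplete (maximalIdeal R) R] (x : ι → R) (hx : ∀ i, x i ∈ maximalIdeal R) (e : ℕ)
    (he : maximalIdeal R ^ e ≤ Ideal.span (Set.range x))
    (hchar : ∀ n : ℕ, (n : ResidueField R) = 0 → ∃ a : ι → ℕ, (n : R) = ∑ i, (a i : R) * x i) :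
    ∃ A : Subring R, Module.Finite A R ∧ IsNoetherianRing A ∧ ∃ _ : IsLocalRing A,
      ∃ y : ι → A, maximalIdeal A = Ideal.span (Set.range y) := by
  obtain ⟨C, hanti, hC, hstep⟩ := exists_antitone_isCoefficientSubring x hx e he hchar
  set q := Ideal.span (Set.range x) with hq
  have hqm : q ≤ maximalIdeal R := by
    rw [hq, Ideal.span_le]; rintro _ ⟨i, rfl⟩; exact hx i
  let A : Subring R := ⨅ n, C n
  have hA : ∀ z, z ∈ A ↔ ∀ n, z ∈ C n := fun z => Subring.mem_iInf
  have hxA : ∀ i, x i ∈ A := fun i => (hA _).mpr fun n => (hC n).gen_mem i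
  -- A is q-adically closed, since each `C n` contains a power of q.
  have hclosed : ∀ L, (∀ n, ∃ a ∈ A, L - a ∈ q ^ n) → L ∈ A := by
    intro L hL
    rw [hA]
    intro n
    obtain ⟨a, ha, haL⟩ := hL (n + 1)
    simpa using (C n).add_mem ((hC n).pow_le _ haL) ((hA a).mp ha n)
  -- Successive corrections into `C (n + 1)`, `C (n + 2)`, … converge, and the limit lies in every
  -- `C m`.
  have happrox : ∀ n, ∀ c ∈ C n, ∃ a ∈ A, c - a ∈ q ^ (n + 1) := by
    intro n c hc
    choose! g hg hg' using hstep
    let f : ℕ → R := fun j => Nat.rec c (fun j z => g (n + j) z) j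
    have hfC : ∀ j, f j ∈ C (n + j) := by
      intro j
      induction j with
      | zero => exact hc
      | succ j ih => exact hg _ _ ih
    have hf : ∀ j, f (j + 1) - f j ∈ q ^ (n + j + 1) := fun j => by
      rw [← neg_mem_iff, neg_sub]; exact hg' _ _ (hfC j)
    obtain ⟨L, hL⟩ := exists_limit_of_maximalIdeal_pow_le hqm he
      (fun j => f (j - n)) (by
        intro j
        rcases lt_or_ge j n with hj | hj
        · rw [show j + 1 - n = 0 by omega, show j - n = 0 by omega]; simp
        · obtain ⟨i, rfl⟩ := Nat.exists_eq_add_of_le hj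
          have := Ideal.pow_le_pow_right (Nat.le_succ (n + i)) (hf i)
          rwa [show n + i + 1 - n = i + 1 by omega, show n + i - n = i by omega])
    have hL' : ∀ j, L - f j ∈ q ^ (n + j) := fun j => by
      have := hL (n + j)
      rwa [show n + j - n = j by omega] at this
    refine ⟨L, (hA L).mpr fun m => ?_, ?_⟩
    · have h1 : L - f (m + 1) ∈ C m := (hC m).pow_le _
        (Ideal.pow_le_pow_right (by omega) (hL' (m + 1)))
      simpa using (C m).add_mem h1 (hanti (by omega) (hfC (m + 1)))
    · have h1 := hL' 1
      have h2 : f 1 - c ∈ q ^ (n + 1) := hf 0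
      rw [← neg_mem_iff, neg_sub]
      simpa using Ideal.add_mem _ h1 h2
  have hsurj : ∀ r, ∃ a ∈ A, r - a ∈ maximalIdeal R := by
    intro r
    obtain ⟨c, hc, hcr⟩ := (hC 0).surj r
    obtain ⟨a, ha, hac⟩ := happrox 0 c hc
    refine ⟨a, ha, ?_⟩
    simpa using Ideal.add_mem _ hcr (hqm (Ideal.pow_le_self (by omega) hac))
  -- `R` is generated over `A` by finitely many elements modulo each power of the maximal ideal
  have hgen : ∀ j, ∃ s : Finset R, ∀ r, ∃ w ∈ Submodule.span A (s : Set R),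
      r - w ∈ maximalIdeal R ^ j := by
    classical
    intro j
    induction j with
    | zero => exact ⟨∅, fun r => ⟨0, Submodule.zero_mem _, by simp⟩⟩
    | succ j ih =>
      obtain ⟨s, hs⟩ := ih
      obtain ⟨t, ht⟩ := (IsNoetherian.noetherian (maximalIdeal R ^ j) : (maximalIdeal R ^ j).FG)
      have ht' : ∀ z ∈ maximalIdeal R ^ j, ∃ w ∈ Submodule.span A (t : Set R),
          z - w ∈ maximalIdeal R ^ (j + 1) := by
        intro z hz
        rw [← ht] at hz
        induction hz using Submodule.span_induction with
        | mem u hu => exact ⟨u, Submodule.subset_span hu, by simp⟩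
        | zero => exact ⟨0, Submodule.zero_mem _, by simp⟩
        | add u v _ _ hu hv =>
          obtain ⟨w, hw, hw'⟩ := hu
          obtain ⟨w₁, hw₁, hw₁'⟩ := hv
          refine ⟨w + w₁, Submodule.add_mem _ hw hw₁, ?_⟩
          convert Ideal.add_mem _ hw' hw₁' using 1
          ring
        | smul c u hu' hu =>
          obtain ⟨w, hw, hw'⟩ := hu
          obtain ⟨a, ha, hac⟩ := hsurj c
          have hum : u ∈ maximalIdeal R ^ j := by rw [← ht]; exact hu'
          refine ⟨(⟨a, ha⟩ : A) • w, Submodule.smul_mem _ _ hw, ?_⟩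
          have h1 : (c - a) * u ∈ maximalIdeal R ^ (j + 1) := by
            rw [pow_succ']; exact Ideal.mul_mem_mul hac hum
          have h2 := Ideal.add_mem _ h1 (Ideal.mul_mem_left _ a hw')
          convert h2 using 1
          rw [Subring.smul_def, smul_eq_mul, smul_eq_mul]
          ring
      refine ⟨s ∪ t, fun r => ?_⟩
      obtain ⟨w, hw, hwr⟩ := hs r
      obtain ⟨w', hw', hwr'⟩ := ht' _ hwr
      refine ⟨w + w', Submodule.add_mem _ (Submodule.span_mono (by simp) hw)
        (Submodule.span_mono (by simp) hw'), ?_⟩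
      rwa [← sub_sub]
  obtain ⟨s, hs⟩ := hgen e
  -- The x_i lie in A, so spanning R modulo q propagates to every q^n with coefficients in A ∩ q^n.
  -- The resulting series of coefficients converge in A because A is closed.
  have hs' : ∀ n, ∀ z ∈ q ^ n, ∃ a : s → R, (∀ i, a i ∈ A ∧ a i ∈ q ^ n) ∧
      z - ∑ i, a i * i ∈ q ^ (n + 1) := by
    intro n
    induction n with
    | zero =>
      intro z _
      obtain ⟨w, hw, hwz⟩ := hs z
      obtain ⟨a, rfl⟩ := (Submodule.mem_span_finset' (R := A)).mp hw
      refine ⟨fun i => a i, fun i => ⟨(a i).2, by simp⟩, ?_⟩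
      rw [zero_add, pow_one]
      exact he hwz
    | succ n ih =>
      intro z hz
      rw [pow_succ', hq, Ideal.mem_span_range_mul_iff] at hz
      obtain ⟨b, hb, rfl⟩ := hz
      choose a ha ha' using fun i => ih (b i) (hb i)
      refine ⟨fun k => ∑ i, a i k * x i, fun k => ⟨A.sum_mem fun i _ =>
        A.mul_mem (ha i k).1 (hxA i), ?_⟩, ?_⟩
      · rw [pow_succ', hq, Ideal.mem_span_range_mul_iff]
        exact ⟨fun i => a i k, fun i => (ha i k).2, rfl⟩
      · rw [pow_succ', hq, Ideal.mem_span_range_mul_iff]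
        refine ⟨_, ha', ?_⟩
        simp only [Finset.sum_mul, sub_mul, Finset.sum_sub_distrib]
        congr 1
        rw [Finset.sum_comm]
        exact Finset.sum_congr rfl fun i _ => Finset.sum_congr rfl fun k _ => by ring
  have hfin : Module.Finite A R := by
    refine ⟨⟨s, ?_⟩⟩
    rw [eq_top_iff]
    rintro r -
    choose! a ha ha' using hs'
    let f : ℕ → R := fun n => Nat.rec r (fun n z => z - ∑ i, a n z i * i) n
    have hf : ∀ n, f n ∈ q ^ n := by
      intro n
      induction n with
      | zero => simp
      | succ n ih => exact ha' n _ ih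
    have hf1 : ∀ n, f (n + 1) = f n - ∑ i, a n (f n) i * i := fun n => rfl
    let b : s → ℕ → R := fun i n => ∑ j ∈ Finset.range n, a j (f j) i
    have hb : ∀ i n, b i n ∈ A := fun i n => A.sum_mem fun j _ => (ha j _ (hf j) i).1
    have hrb : ∀ n, r - ∑ i, b i n * i = f n := by
      intro n
      induction n with
      | zero => simp [b, f]
      | succ n ih =>
        have h1 : ∀ i, b i (n + 1) = b i n + a n (f n) i := fun i => Finset.sum_range_succ _ _
        simp only [hf1, h1, add_mul, Finset.sum_add_distrib]
        rw [← sub_sub, ih]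
    choose L hL using fun i => exists_limit_of_maximalIdeal_pow_le hqm he (b i) (by
      intro n
      simp only [b, Finset.sum_range_succ, add_sub_cancel_left]
      exact (ha n _ (hf n) i).2)
    have hLA : ∀ i, L i ∈ A := fun i => hclosed _ fun n => ⟨b i n, hb i n, hL i n⟩
    have hr : r = ∑ i, L i * i := by
      rw [← sub_eq_zero]
      refine IsHausdorff.haus (I := maximalIdeal R) (M := R) inferInstance _ fun n => ?_
      rw [SModEq.zero, smul_eq_mul, Ideal.mul_top]
      refine Ideal.pow_right_mono hqm n ?_
      have h1 : ∑ i, (L i - b i n) * (i : R) ∈ q ^ n :=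
        Ideal.sum_mem _ fun i _ => Ideal.mul_mem_right _ _ (hL i n)
      have h2 := Ideal.sub_mem _ (hf n) h1
      rw [← hrb n] at h2
      simp only [sub_mul, Finset.sum_sub_distrib] at h2
      convert h2 using 1
      ring
    rw [hr]
    exact Submodule.sum_mem _ fun i _ => Submodule.smul_mem _ (⟨L i, hLA i⟩ : A)
      (Submodule.subset_span i.2)
  have hnoeth : IsNoetherianRing A := isNoetherianRing_of_finite_of_isNoetherianRing A R
  have hint : (algebraMap A R).IsIntegral := Algebra.IsIntegral.isIntegral
  have hlh : IsLocalHom (algebraMap A R) := hint.isLocalHom (FaithfulSMul.algebraMap_injective A R)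
  have hloc : IsLocalRing A := RingHom.domain_isLocalRing (algebraMap A R)
  let y : ι → A := fun i => ⟨x i, hxA i⟩
  have hmA : ∀ a : A, a ∈ maximalIdeal A ↔ (a : R) ∈ maximalIdeal R := fun a => by
    rw [mem_maximalIdeal, mem_maximalIdeal, mem_nonunits_iff, mem_nonunits_iff, not_iff_not]
    exact (isUnit_map_iff (algebraMap A R) a).symm
  have hle : Ideal.span (Set.range y) ≤ maximalIdeal A := by
    rw [Ideal.span_le]; rintro _ ⟨i, rfl⟩; exact (hmA _).mpr (hx i)
  refine ⟨A, hfin, hnoeth, hloc, y, le_antisymm ?_ hle⟩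
  intro c hc
  let N := Ideal.span (Set.range y)
  have hmap : N.map (algebraMap A R) = q := by
    rw [Ideal.map_span, hq, ← Set.range_comp]; rfl
  let f : A →ₗ[A] R := Algebra.linearMap A R
  have hN : ∀ z : R, z ∈ Submodule.map f N ↔ ∃ a ∈ N, (a : R) = z := fun z => Iff.rfl
  -- The element c is congruent to an element of N modulo q^n ⊆ m_A^n R for every n, and Krull's
  -- intersection theorem holds for the finite A-module R/N.
  have hzero : Submodule.Quotient.mk (p := Submodule.map f N) (c : R) = 0 := by
    refine IsHausdorff.haus (I := maximalIdeal A) (M := R ⧸ Submodule.map f N) inferInstance _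
      fun n => ?_
    obtain ⟨a, ha, hac⟩ := (hC n).exists_sub_mem c ((hA _).mp c.2 n) ((hmA c).mp hc)
    choose b hb hab using fun i => happrox n (a i) (ha i)
    have h1 : (c : R) - ∑ i, b i * x i ∈ q ^ n := by
      have h2 : ∑ i, (a i - b i) * x i ∈ q ^ (n + 1) :=
        Ideal.sum_mem _ fun i _ => Ideal.mul_mem_right _ _ (hab i)
      have h3 := Ideal.pow_le_pow_right (Nat.le_succ n) (Ideal.add_mem _ hac h2)
      simp only [sub_mul, Finset.sum_sub_distrib] at h3
      convert h3 using 1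
      ring
    have h4 : Submodule.Quotient.mk (p := Submodule.map f N) (c : R) =
        Submodule.Quotient.mk ((c : R) - ∑ i, b i * x i) := by
      rw [eq_comm, Submodule.Quotient.eq, hN]
      refine ⟨-∑ i, (⟨b i, hb i⟩ : A) * y i, neg_mem (Ideal.sum_mem _ fun i _ =>
        Ideal.mul_mem_left _ _ (Ideal.subset_span ⟨i, rfl⟩)), ?_⟩
      simp [y]
    rw [SModEq.zero, h4]
    have h5 : (c : R) - ∑ i, b i * x i ∈ ((maximalIdeal A) ^ n • ⊤ : Submodule A R) := by
      rw [Ideal.smul_top_eq_map, Submodule.restrictScalars_mem]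
      refine Ideal.map_mono (Ideal.pow_right_mono hle n) ?_
      rw [Ideal.map_pow]
      change _ ∈ (N.map (algebraMap A R)) ^ n
      rwa [hmap]
    have h6 := Submodule.mem_map_of_mem (f := Submodule.mkQ (Submodule.map f N)) h5
    rw [Submodule.map_smul''] at h6
    exact Submodule.smul_mono le_rfl le_top h6
  rw [Submodule.Quotient.mk_eq_zero, hN] at hzero
  obtain ⟨a, ha, hac⟩ := hzero
  rwa [← Subtype.ext hac]

end

/-! ### Regular sequences, associated primes and regular local rings. -/

section

variable {A : Type*} [CommRing A]

/-- `t` is a nonzerodivisor modulo the ideal `b`. -/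
def Ideal.IsRegularMod (b : Ideal A) (t : A) : Prop := ∀ r, t * r ∈ b → r ∈ b

/-- `p` is the annihilator of an element of `A ⧸ b` and prime. -/
def Ideal.IsAssociatedTo (b p : Ideal A) : Prop := p.IsPrime ∧ ∃ z, ∀ r, r ∈ p ↔ r * z ∈ b

theorem Ideal.mem_sup_span_singleton_iff {b : Ideal A} {t z : A} :
    z ∈ b ⊔ Ideal.span {t} ↔ ∃ w, z - t * w ∈ b := by
  rw [Submodule.mem_sup]
  constructor
  · rintro ⟨u, hu, v, hv, rfl⟩
    obtain ⟨w, rfl⟩ := Ideal.mem_span_singleton'.mp hv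
    exact ⟨w, by convert hu using 1; ring⟩
  · rintro ⟨w, hw⟩
    exact ⟨_, hw, t * w, Ideal.mul_mem_right _ _ (Ideal.mem_span_singleton_self t), by ring⟩

theorem Ideal.isAssociatedTo_iff [IsNoetherianRing A] {b p : Ideal A} :
    b.IsAssociatedTo p ↔ IsAssociatedPrime p (A ⧸ b) := by
  rw [isAssociatedPrime_iff, Ideal.IsAssociatedTo]
  refine and_congr_right fun _ => ?_
  constructor
  · rintro ⟨z, hz⟩
    refine ⟨Ideal.Quotient.mk b z, ?_⟩
    ext r
    rw [hz, Submodule.mem_colon_singleton, Submodule.mem_bot, ← Ideal.Quotient.eq_zero_iff_mem]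
    rfl
  · rintro ⟨z, rfl⟩
    obtain ⟨z, rfl⟩ := Ideal.Quotient.mk_surjective z
    refine ⟨z, fun r => ?_⟩
    rw [Submodule.mem_colon_singleton, Submodule.mem_bot, ← Ideal.Quotient.eq_zero_iff_mem]
    rfl

theorem Ideal.IsAssociatedTo.notMem {b p : Ideal A} (h : p.IsPrime) {z : A}
    (hz : ∀ r, r ∈ p ↔ r * z ∈ b) : z ∉ b := fun hzb =>
  h.ne_top ((Ideal.eq_top_iff_one _).mpr ((hz 1).mpr (by rwa [one_mul])))

theorem Ideal.exists_isAssociatedTo [IsNoetherianRing A] {b : Ideal A} {z : A} (hz : z ∉ b) :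
    ∃ p, b.IsAssociatedTo p ∧ ∀ r, r * z ∈ b → r ∈ p := by
  obtain ⟨p, hp, hzp⟩ := exists_le_isAssociatedPrime_of_isNoetherianRing A
    (Ideal.Quotient.mk b z) (by rwa [Ne, Ideal.Quotient.eq_zero_iff_mem])
  refine ⟨p, Ideal.isAssociatedTo_iff.mpr hp, fun r hr => hzp ?_⟩
  rw [Submodule.mem_colon_singleton, Submodule.mem_bot]
  exact Ideal.Quotient.eq_zero_iff_mem.mpr hr

theorem Ideal.exists_isRegularMod [IsNoetherianRing A] (I : Ideal A) (s : Finset (Ideal A))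
    (h : ∀ b ∈ s, ∀ p, b.IsAssociatedTo p → ¬ I ≤ p) :
    ∃ t ∈ I, ∀ b ∈ s, b.IsRegularMod t := by
  by_contra! hcon
  have hfin : (⋃ b ∈ s, {p | b.IsAssociatedTo p}).Finite := by
    refine s.finite_toSet.biUnion fun b _ => ?_
    simp only [Ideal.isAssociatedTo_iff]
    exact associatedPrimes.finite A (A ⧸ b)
  have hsub : (I : Set A) ⊆ ⋃ p ∈ (⋃ b ∈ s, {p | b.IsAssociatedTo p}), (p : Set A) := by
    intro t ht
    obtain ⟨b, hb, hbt⟩ := hcon t ht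
    simp only [Ideal.IsRegularMod, not_forall] at hbt
    obtain ⟨z, hz, hzb⟩ := hbt
    obtain ⟨p, hp, hzp⟩ := Ideal.exists_isAssociatedTo hzb
    exact Set.mem_biUnion (Set.mem_biUnion hb hp) (hzp t hz)
  obtain ⟨p, hp, hIp⟩ := (Ideal.subset_union_prime_finite hfin (f := id) ⊤ ⊤ (by
    intro p hp _ _
    obtain ⟨b, _, hbp⟩ := Set.mem_iUnion₂.mp hp
    exact hbp.1)).mp hsub
  obtain ⟨b, hb, hbp⟩ := Set.mem_iUnion₂.mp hp
  exact h b hb p hbp hIp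

/-- Regular elements may be permuted: if `t` is regular modulo `b` and `s` is regular modulo
`b + (t)`, then `t` is regular modulo `b + (s)`. -/
theorem Ideal.IsRegularMod.swap {b : Ideal A} {s t : A} (ht : b.IsRegularMod t)
    (hst : (b ⊔ Ideal.span {t}).IsRegularMod s) :
    (b ⊔ Ideal.span {s}).IsRegularMod t := by
  intro r hr
  obtain ⟨c, hc⟩ := Ideal.mem_sup_span_singleton_iff.mp hr
  obtain ⟨d, hd⟩ := Ideal.mem_sup_span_singleton_iff.mp (hst c
    (Ideal.mem_sup_span_singleton_iff.mpr ⟨r, by rw [← neg_mem_iff, neg_sub]; exact hc⟩))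
  refine Ideal.mem_sup_span_singleton_iff.mpr ⟨d, ht _ ?_⟩
  convert Ideal.add_mem _ hc (b.mul_mem_left s hd) using 1
  ring

variable [IsLocalRing A]

/-- There is a regular sequence of length `n` on `A ⧸ b` in the maximal ideal of `A`. -/
def Ideal.DepthGE : ℕ → Ideal A → Prop
  | 0, _ => True
  | n + 1, b => ∃ t ∈ maximalIdeal A, b.IsRegularMod t ∧ DepthGE n (b ⊔ Ideal.span {t})

/-- Induction on the depth. By Nakayama, some element killed by p modulo b survives modulo b + (t).
Its annihilator lies in an associated prime q of b + (t) which contains p and t; since t is not in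
p, the dimension drops strictly from p to q. -/
theorem Ideal.DepthGE.natCast_le_ringKrullDim [IsNoetherianRing A] {n : ℕ} {b p : Ideal A}
    (hb : b.DepthGE n) (hp : b.IsAssociatedTo p) : n ≤ ringKrullDim (A ⧸ p) := by
  induction n generalizing b p with
  | zero =>
    have := hp.1
    have : Nontrivial (A ⧸ p) := inferInstance
    simpa using ringKrullDim_nonneg_of_nontrivial
  | succ n ih =>
    obtain ⟨t, htm, ht, htb⟩ := hb
    obtain ⟨hpp, z, hz⟩ := hp
    have hzb := Ideal.IsAssociatedTo.notMem hpp hz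
    let N : Ideal A := b.colon p
    have hN : ∀ x, x ∈ N ↔ ∀ r ∈ p, x * r ∈ b := fun x => Submodule.mem_colon
    have hbN : b ≤ N := fun x hx => (hN x).mpr fun r _ => b.mul_mem_right _ hx
    have hNt : ¬ N ≤ b ⊔ Ideal.span {t} := by
      intro hle
      refine hzb (Submodule.le_of_le_smul_of_le_jacobson_bot (I := maximalIdeal A) (N' := N)
        (IsNoetherian.noetherian N) (maximalIdeal_le_jacobson _) ?_
        ((hN z).mpr fun r hr => by rw [mul_comm]; exact (hz r).mp hr))
      intro x hx
      obtain ⟨w, hw⟩ := Ideal.mem_sup_span_singleton_iff.mp (hle hx)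
      refine Submodule.mem_sup.mpr ⟨_, hw, t * w, ?_, by ring⟩
      refine Submodule.smul_mem_smul htm ((hN w).mpr fun r hr => ht _ ?_)
      have := b.sub_mem ((hN x).mp hx r hr) (b.mul_mem_right r hw)
      convert this using 1
      ring
    obtain ⟨y, hyN, hy⟩ := Set.not_subset.mp hNt
    obtain ⟨q, hq, hyq⟩ := Ideal.exists_isAssociatedTo hy
    have hpq : p ≤ q := fun r hr => hyq r (by
      rw [mul_comm]; exact Ideal.mem_sup_left ((hN y).mp hyN r hr))
    have htq : t ∈ q := hyq t (Ideal.mem_sup_right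
      (Ideal.mul_mem_right _ _ (Ideal.mem_span_singleton_self t)))
    have htp : t ∉ p := fun h => hzb (ht z ((hz t).mp h))
    have hdim : ringKrullDim (A ⧸ q) + 1 ≤ ringKrullDim (A ⧸ p) :=
      ringKrullDim_succ_le_of_surjective (Ideal.Quotient.factor hpq)
        (Ideal.Quotient.factor_surjective hpq) (r := Ideal.Quotient.mk p t)
        (mem_nonZeroDivisors_of_ne_zero (by rwa [Ne, Ideal.Quotient.eq_zero_iff_mem]))
        (Ideal.Quotient.eq_zero_iff_mem.mpr htq)
    refine le_trans ?_ hdim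
    rw [Nat.cast_add, Nat.cast_one]
    gcongr
    exact ih htb hq

/-- A trivial socle means that the maximal ideal is not associated, so prime avoidance finds one
element regular modulo all the given ideals. -/
theorem Ideal.isRegularMod_of_forall_maximalIdeal [IsNoetherianRing A] (s : Finset (Ideal A))
    (h : ∀ b ∈ s, ∀ z, (∀ r ∈ maximalIdeal A, r * z ∈ b) → z ∈ b) :
    ∃ t ∈ maximalIdeal A, ∀ b ∈ s, b.IsRegularMod t := by
  refine Ideal.exists_isRegularMod _ s fun b hb p hp hle => ?_
  obtain ⟨hpp, z, hz⟩ := hp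
  exact Ideal.IsAssociatedTo.notMem hpp hz (h b hb z fun r hr => (hz r).mp (hle hr))

/-- Dividing by a regular element of the maximal ideal drops the depth by at most one. -/
theorem Ideal.DepthGE.sup_span_singleton [IsNoetherianRing A] {n : ℕ} {b : Ideal A} {a : A}
    (hb : b.DepthGE (n + 1)) (ham : a ∈ maximalIdeal A) (ha : b.IsRegularMod a) :
    (b ⊔ Ideal.span {a}).DepthGE n := by
  classical
  induction n generalizing b a with
  | zero => trivial
  | succ n ih =>
    obtain ⟨t, htm, ht, htb⟩ := hb
    have hsoc : ∀ z, (∀ r ∈ maximalIdeal A, r * z ∈ b ⊔ Ideal.span {t}) →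
        z ∈ b ⊔ Ideal.span {t} := by
      obtain ⟨t', htm', ht', -⟩ := htb
      exact fun z hz => ht' z (hz t' htm')
    obtain ⟨s, hsm, hs⟩ := Ideal.isRegularMod_of_forall_maximalIdeal
      {b, b ⊔ Ideal.span {t}, b ⊔ Ideal.span {a}} (by
        intro c hc
        simp only [Finset.mem_insert, Finset.mem_singleton] at hc
        rcases hc with rfl | rfl | rfl
        · exact fun z hz => ht z (hz t htm)
        · exact hsoc
        -- The socle of A/(b + (a)) vanishes because that of A/(b + (t)) does: a socle element z
        -- satisfies t z = a w modulo b, and w is a socle element modulo b + (t).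
        · intro z hz
          obtain ⟨w, hw⟩ := Ideal.mem_sup_span_singleton_iff.mp (hz t htm)
          have hwt : w ∈ b ⊔ Ideal.span {t} := by
            refine hsoc w fun r hr => ?_
            obtain ⟨c, hc⟩ := Ideal.mem_sup_span_singleton_iff.mp (hz r hr)
            refine Ideal.mem_sup_span_singleton_iff.mpr ⟨c, ha _ ?_⟩
            convert b.sub_mem (b.mul_mem_left t hc) (b.mul_mem_left r hw) using 1
            ring
          obtain ⟨c, hc⟩ := Ideal.mem_sup_span_singleton_iff.mp hwt
          refine Ideal.mem_sup_span_singleton_iff.mpr ⟨c, ht _ ?_⟩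
          convert b.add_mem hw (b.mul_mem_left a hc) using 1
          ring)
    have hs1 := hs b (by simp)
    have hs2 := hs (b ⊔ Ideal.span {t}) (by simp)
    have hs3 := hs (b ⊔ Ideal.span {a}) (by simp)
    -- The common regular element s is exchanged for t, then for a; the induction hypothesis is used
    -- once in each exchange.
    have h1 : (b ⊔ Ideal.span {s}).DepthGE (n + 1) := by
      refine ⟨t, htm, ht.swap hs2, ?_⟩
      rw [sup_right_comm]
      exact ih htb hsm hs2
    have ha' : (b ⊔ Ideal.span {s}).IsRegularMod a := ha.swap hs3
    refine ⟨s, hsm, hs3, ?_⟩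
    rw [sup_right_comm]
    exact ih h1 ham ha'

theorem Ideal.DepthGE.comap_mk {I : Ideal A} [IsLocalRing (A ⧸ I)] {n : ℕ} {b : Ideal (A ⧸ I)}
    (hb : b.DepthGE n) : (b.comap (Ideal.Quotient.mk I)).DepthGE n := by
  induction n generalizing b with
  | zero => trivial
  | succ n ih =>
    obtain ⟨t, htm, ht, htb⟩ := hb
    obtain ⟨t, rfl⟩ := Ideal.Quotient.mk_surjective t
    refine ⟨t, ?_, fun r hr => ht _ (by rw [← map_mul]; exact hr), ?_⟩
    · rw [mem_maximalIdeal, mem_nonunits_iff] at htm ⊢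
      exact fun h => htm (h.map _)
    · have : (b ⊔ Ideal.span {Ideal.Quotient.mk I t}).comap (Ideal.Quotient.mk I) =
          b.comap (Ideal.Quotient.mk I) ⊔ Ideal.span {t} := by
        ext z
        rw [Ideal.mem_comap, Ideal.mem_sup_span_singleton_iff, Ideal.mem_sup_span_singleton_iff]
        constructor
        · rintro ⟨w, hw⟩
          obtain ⟨w, rfl⟩ := Ideal.Quotient.mk_surjective w
          exact ⟨w, by rwa [Ideal.mem_comap, map_sub, map_mul]⟩
        · rintro ⟨w, hw⟩
          exact ⟨Ideal.Quotient.mk I w, by rwa [Ideal.mem_comap, map_sub, map_mul] at hw⟩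
      rw [← this]
      exact ih htb

end

/-- If the maximal ideal of a Noetherian local ring `A` is generated by `dim A` elements, then `A`
is a domain and has a regular sequence of length `dim A`. -/
theorem isDomain_and_depthGE_of_maximalIdeal_eq_span {A : Type*} [CommRing A] [IsLocalRing A]
    [IsNoetherianRing A] {n : ℕ} (hn : n ≤ ringKrullDim A) (y : Fin n → A)
    (hy : maximalIdeal A = Ideal.span (Set.range y)) : IsDomain A ∧ (⊥ : Ideal A).DepthGE n := by
  induction n generalizing A with
  | zero =>
    rw [Set.range_eq_empty, Ideal.span_empty] at hy
    exact ⟨(isField_iff_maximalIdeal_eq.mpr hy).isDomain, trivial⟩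
  | succ n ih =>
    have hne : ¬ maximalIdeal A ∈ minimalPrimes A := by
      intro h
      have h1 : (maximalIdeal A).height = 0 := by
        exact Ideal.height_eq_zero_iff.mpr h
      rw [← maximalIdeal_height_eq_ringKrullDim, h1] at hn
      norm_cast at hn
    -- Prime avoidance tolerates the non-prime ideal m². Outside m², x can replace one generator of
    -- m; outside the minimal primes, it will force A to be a domain.
    obtain ⟨x, hxm, hx⟩ : ∃ x ∈ maximalIdeal A,
        x ∉ ⋃ p ∈ insert (maximalIdeal A ^ 2) (minimalPrimes A), (p : Set A) := by
      refine Set.not_subset.mp fun hsub => ?_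
      obtain ⟨p, hp, hle⟩ := (Ideal.subset_union_prime_finite
        ((Ideal.finite_minimalPrimes_of_isNoetherianRing A ⊥).insert _) (f := id) (maximalIdeal A ^ 2)
        (maximalIdeal A ^ 2) (fun p hp h _ => (hp.resolve_left h).1.1)).mp hsub
      rcases hp with rfl | hp
      · have hbot : maximalIdeal A ≤ ⊥ := Submodule.le_of_le_smul_of_le_jacobson_bot
          (I := maximalIdeal A) (IsNoetherian.noetherian _) (maximalIdeal_le_jacobson _) (by
            rw [bot_sup_eq, smul_eq_mul, ← pow_two]; exact hle)
        refine hne ⟨⟨inferInstance, bot_le⟩, fun q _ _ => hbot.trans bot_le⟩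
      · have := hp.1.1
        exact hne (((maximalIdeal.isMaximal A).eq_of_le hp.1.1.ne_top hle).symm ▸ hp)
    simp only [Set.mem_insert_iff, Set.iUnion_iUnion_eq_or_left, Set.mem_union, not_or,
      Set.mem_iUnion, not_exists] at hx
    obtain ⟨hx2, hxp⟩ := hx
    have hxtop : Ideal.span {x} ≠ ⊤ := fun h =>
      (mem_maximalIdeal _).mp hxm (Ideal.span_singleton_eq_top.mp h)
    let B := A ⧸ Ideal.span {x}
    have : Nontrivial B := Ideal.Quotient.nontrivial_iff.mpr hxtop
    have : IsLocalRing B := .of_surjective' (Ideal.Quotient.mk _) Ideal.Quotient.mk_surjective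
    have hmB : maximalIdeal B = (maximalIdeal A).map (Ideal.Quotient.mk (Ideal.span {x})) := by
      have := IsLocalHom.of_surjective (Ideal.Quotient.mk (Ideal.span {x}))
        Ideal.Quotient.mk_surjective
      ext b
      obtain ⟨b, rfl⟩ := Ideal.Quotient.mk_surjective b
      simp only [mem_maximalIdeal, mem_nonunits_iff, isUnit_map_iff]
      rw [Ideal.mem_quotient_iff_mem (le_maximalIdeal hxtop)]
      rfl
    have hB : (n : WithBot ℕ∞) ≤ ringKrullDim B := by
      have h1 := ringKrullDim_le_ringKrullDim_quotient_add_card {x} (by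
        rw [Finset.coe_singleton, Set.singleton_subset_iff, ringJacobson_eq_maximalIdeal]
        exact hxm)
      rw [Finset.coe_singleton, Finset.card_singleton] at h1
      have h2 := hn.trans h1
      rw [Nat.cast_add] at h2
      exact (WithBot.add_le_add_iff_right' (WithBot.natCast_ne_bot 1)
        (fun h => ENat.natCast_ne_top 1 (WithBot.coe_injective h))).mp h2
    obtain ⟨a, ha⟩ := Ideal.mem_span_range_iff_exists_fun.mp (hy ▸ hxm)
    obtain ⟨i, hi⟩ : ∃ i, IsUnit (a i) := by
      by_contra! hcon
      refine hx2 ?_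
      rw [← ha, pow_two]
      exact Ideal.sum_mem _ fun i _ => Ideal.mul_mem_mul ((mem_maximalIdeal _).mpr (hcon i))
        (hy ▸ Ideal.subset_span ⟨i, rfl⟩)
    have hspan : maximalIdeal B =
        Ideal.span (Set.range fun j => Ideal.Quotient.mk _ (y (i.succAbove j))) := by
      refine le_antisymm ?_ ?_
      · rw [hmB, hy, Ideal.map_span, Ideal.span_le]
        rintro _ ⟨_, ⟨j, rfl⟩, rfl⟩
        rcases Fin.eq_self_or_eq_succAbove i j with rfl | ⟨j, rfl⟩
        · obtain ⟨u, hu⟩ := hi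
          have h1 : Ideal.Quotient.mk (Ideal.span {x}) (y j) =
              - ∑ k, Ideal.Quotient.mk (Ideal.span {x}) (↑u⁻¹ * a (j.succAbove k)) *
                Ideal.Quotient.mk (Ideal.span {x}) (y (j.succAbove k)) := by
            rw [eq_neg_iff_add_eq_zero]
            simp only [← map_mul, ← map_sum, ← map_add]
            rw [Ideal.Quotient.eq_zero_iff_mem]
            refine Ideal.mem_span_singleton'.mpr ⟨↑u⁻¹, ?_⟩
            rw [← ha, Fin.sum_univ_succAbove _ j, ← hu, mul_add, ← mul_assoc, Units.inv_mul,
              one_mul, Finset.mul_sum]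
            simp only [mul_assoc]
          rw [h1]
          exact neg_mem (Ideal.sum_mem _ fun k _ => Ideal.mul_mem_left _ _
            (Ideal.subset_span ⟨k, rfl⟩))
        · exact Ideal.subset_span ⟨j, rfl⟩
      · rw [Ideal.span_le, hmB]
        rintro _ ⟨j, rfl⟩
        exact Ideal.mem_map_of_mem _ (hy ▸ Ideal.subset_span ⟨_, rfl⟩)
    obtain ⟨hdom, hdepth⟩ := ih hB _ hspan
    have hprime : (Ideal.span {x}).IsPrime := (Ideal.Quotient.isDomain_iff_prime _).mp hdom
    obtain ⟨p, hp, hpx⟩ := Ideal.exists_minimalPrimes_le (I := ⊥) (J := Ideal.span {x}) bot_le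
    have hxp' : x ∉ p := hxp p hp
    -- Since p ⊆ (x) with x not in p, p = xp, and Nakayama gives p = 0.
    have hpbot : p ≤ ⊥ := by
      refine Submodule.le_of_le_smul_of_le_jacobson_bot
          (I := maximalIdeal A) (IsNoetherian.noetherian _) (maximalIdeal_le_jacobson _) ?_
      rw [bot_sup_eq]
      intro z hz
      obtain ⟨r, rfl⟩ := Ideal.mem_span_singleton'.mp (hpx hz)
      rw [mul_comm]
      exact Ideal.mul_mem_mul hxm ((hp.1.1.mem_or_mem hz).resolve_right hxp')
    have hAdom : IsDomain A := by
      have := hp.1.1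
      rw [le_bot_iff.mp hpbot] at this
      have := (Ideal.Quotient.isDomain_iff_prime (⊥ : Ideal A)).mpr this
      exact (RingEquiv.quotientBot A).symm.toMulEquiv.isDomain _
    refine ⟨hAdom, x, hxm, fun r hr => ?_, ?_⟩
    · rw [Ideal.mem_bot, mul_eq_zero] at hr
      exact hr.resolve_left fun h => hxp' (h ▸ p.zero_mem)
    · have := hdepth.comap_mk
      rwa [← RingHom.ker_eq_comap_bot, Ideal.mk_ker, ← bot_sup_eq (Ideal.span {x})] at this

/-! ### Second syzygies and the reflexive hull. -/

section

variable {A K L : Type*} [CommRing A] [IsDomain A] [IsNoetherianRing A] [Field K] [Algebra A K]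
  [IsFractionRing A K] [AddCommGroup L] [Module K L] [Module A L] [IsScalarTower A K L]

/-- The vectors in a subspace of `K ^ n` with integral coordinates form a second syzygy. -/
theorem exists_exact_of_injective_to_fractions {n : ℕ} (Φ : L →ₗ[K] (Fin n → K))
    (hΦ : Function.Injective Φ) (M : Submodule A L)
    (hM : ∀ y, y ∈ M ↔ ∀ j, ∃ a, algebraMap A K a = Φ y j) :
    M.FG ∧ ∃ i : M →ₗ[A] (Fin n → A), Function.Injective i ∧ ∃ (t : ℕ)
      (φ : (Fin n → A) →ₗ[A] (Fin t → A)), Function.Exact i φ := by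
  classical
  have hK := IsFractionRing.injective A K
  have : ∀ m : M, ∃ v : Fin n → A, ∀ j, algebraMap A K (v j) = Φ m j := fun m => by
    choose v hv using (hM m).mp m.2
    exact ⟨v, hv⟩
  choose f hf using this
  let i : M →ₗ[A] (Fin n → A) :=
    { toFun := f
      map_add' := fun x y => by
        ext j
        apply hK
        simp [hf]
      map_smul' := fun a x => by
        ext j
        apply hK
        simp only [hf, Submodule.coe_smul, RingHom.id_apply, Pi.smul_apply, smul_eq_mul, map_mul]
        rw [← algebraMap_smul K a (x : L), map_smul, Pi.smul_apply, smul_eq_mul] }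
  have hi : Function.Injective i := fun x y h => by
    refine Subtype.ext (hΦ (funext fun j => ?_))
    rw [← hf, ← hf]
    exact congrArg _ (congrFun h j)
  refine ⟨?_, i, hi, ?_⟩
  · have : IsNoetherian A M := isNoetherian_of_injective i hi
    exact Module.Finite.iff_fg.mp inferInstance
  -- φ is given by linear equations cutting out the image of Φ, after clearing denominators.
  · let b := Module.finBasis K ((Fin n → K) ⧸ LinearMap.range Φ)
    let ψ : (Fin n → K) →ₗ[K] (Fin _ → K) :=
      b.equivFun.toLinearMap ∘ₗ (LinearMap.range Φ).mkQ
    have hψ : ∀ v, ψ v = 0 ↔ v ∈ LinearMap.range Φ := fun v => by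
      simp only [ψ, LinearMap.comp_apply, LinearEquiv.coe_coe, LinearEquiv.map_eq_zero_iff,
        Submodule.mkQ_apply, Submodule.Quotient.mk_eq_zero]
    obtain ⟨⟨c, hc⟩, hcz⟩ := IsLocalization.exist_integer_multiples_of_finite (nonZeroDivisors A)
      (fun z : Fin n × Fin _ => ψ (Pi.single z.1 1) z.2)
    choose g hg using hcz
    refine ⟨_, Matrix.toLin' (Matrix.of fun k j => g (j, k)), fun v => ?_⟩
    have hv : ∀ k, algebraMap A K (Matrix.toLin' (Matrix.of fun k j => g (j, k)) v k) =
        algebraMap A K c * ψ (fun j => algebraMap A K (v j)) k := fun k => by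
      conv_rhs => rw [LinearMap.pi_apply_eq_sum_univ ψ, Finset.sum_apply, Finset.mul_sum]
      rw [Matrix.toLin'_apply, Matrix.mulVec, dotProduct, map_sum]
      refine Finset.sum_congr rfl fun j _ => ?_
      rw [map_mul, Matrix.of_apply, hg, Algebra.smul_def, Pi.smul_apply, smul_eq_mul]
      have : (fun k => if j = k then (1 : K) else 0) = Pi.single j 1 := by
        ext k
        simp [Pi.single_apply, eq_comm]
      rw [this]
      ring
    have hc0 : algebraMap A K c ≠ 0 := by
      rw [Ne, map_eq_zero_iff _ hK]
      exact nonZeroDivisors.ne_zero hc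
    have hv' : Matrix.toLin' (Matrix.of fun k j => g (j, k)) v = 0 ↔
        ψ (fun j => algebraMap A K (v j)) = 0 := by
      rw [funext_iff, funext_iff]
      refine forall_congr' fun k => ?_
      rw [Pi.zero_apply, Pi.zero_apply, ← map_eq_zero_iff _ hK, hv k, mul_eq_zero, or_iff_right hc0]
    rw [hv', hψ]
    constructor
    · rintro ⟨y, hy⟩
      refine ⟨⟨y, (hM y).mpr fun j => ⟨v j, (congrFun hy j).symm⟩⟩, funext fun j => hK ?_⟩
      exact (hf _ j).trans (congrFun hy j)
    · rintro ⟨m, rfl⟩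
      exact ⟨m, funext fun j => (hf m j).symm⟩

end

section

variable {A K L : Type*} [CommRing A] [Field K] [Algebra A K] [Field L] [Algebra K L] [Algebra A L] [IsScalarTower A K L]

/-- The dual of a lattice in a field extension with respect to the form `(x, y) ↦ τ (x * y)`. -/
def functionalDual (τ : L →ₗ[K] K) (N : Submodule A L) : Submodule A L where
  carrier := {l | ∀ y ∈ N, τ (l * y) ∈ LinearMap.range (Algebra.linearMap A K)}
  add_mem' hx hy z hz := by
    rw [add_mul, map_add]
    exact add_mem (hx z hz) (hy z hz)
  zero_mem' z _ := by
    rw [zero_mul, map_zero]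
    exact zero_mem _
  smul_mem' a x hx z hz := by
    rw [smul_mul_assoc, LinearMap.map_smul_of_tower]
    exact Submodule.smul_mem _ _ (hx z hz)

theorem mem_functionalDual_span {τ : L →ₗ[K] K} {s : Set L} {l : L} :
    l ∈ functionalDual τ (Submodule.span A s) ↔
      ∀ y ∈ s, τ (l * y) ∈ LinearMap.range (Algebra.linearMap A K) := by
  refine ⟨fun h y hy => h y (Submodule.subset_span hy), fun h y hy => ?_⟩
  have : Submodule.span A s ≤ Submodule.comap
      ((τ.restrictScalars A) ∘ₗ (LinearMap.mulLeft A l)) (LinearMap.range (Algebra.linearMap A K)) :=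
    Submodule.span_le.mpr h
  exact this hy

/-- Pairing with finitely many generators of N embeds L in K^n by nondegeneracy, and the dual
lattice becomes the set of vectors with integral coordinates. -/
theorem exists_exact_functionalDual [IsDomain A] [IsFractionRing A K] [IsNoetherianRing A] {τ : L →ₗ[K] K} {N : Submodule A L}
    (hN : N.FG) (h : ∀ l : L, l ≠ 0 → ∃ y ∈ N, τ (l * y) ≠ 0) :
    (functionalDual τ N).FG ∧ ∃ (n : ℕ) (i : functionalDual τ N →ₗ[A] (Fin n → A)),
      Function.Injective i ∧ ∃ (t : ℕ) (φ : (Fin n → A) →ₗ[A] (Fin t → A)),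
        Function.Exact i φ := by
  obtain ⟨n, g, rfl⟩ := Submodule.fg_iff_exists_fin_generating_family.mp hN
  let Φ : L →ₗ[K] (Fin n → K) := LinearMap.pi fun j => τ ∘ₗ LinearMap.mulRight K (g j)
  have hΦ : ∀ l j, Φ l j = τ (l * g j) := fun l j => rfl
  have hinj : Function.Injective Φ := by
    rw [injective_iff_map_eq_zero]
    intro l hl
    by_contra hl0
    obtain ⟨y, hy, hy0⟩ := h l hl0
    refine hy0 ?_
    have : Submodule.span A (Set.range g) ≤
        LinearMap.ker ((τ.restrictScalars A) ∘ₗ (LinearMap.mulLeft A l)) := by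
      rw [Submodule.span_le]
      rintro _ ⟨j, rfl⟩
      exact congrFun hl j
    exact this hy
  obtain ⟨h1, i, hi⟩ := exists_exact_of_injective_to_fractions (A := A) Φ hinj
    (functionalDual τ (Submodule.span A (Set.range g))) (fun y => by
      rw [mem_functionalDual_span, Set.forall_mem_range]
      rfl)
  exact ⟨h1, n, i, hi⟩

variable (A L) {R : Type*} [CommRing R] [Algebra A R] [Algebra R L] [IsScalarTower A R L]

/-- The image of a ring in its fraction field as a lattice. -/
abbrev ringLattice (R : Type*) [CommRing R] [Algebra A R] [Algebra R L] [IsScalarTower A R L] :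
    Submodule A L :=
  LinearMap.range (IsScalarTower.toAlgHom A R L).toLinearMap

variable {L}

theorem mul_mem_functionalDual_ringLattice {τ : L →ₗ[K] K} {y : L}
    (hy : y ∈ functionalDual τ (ringLattice A L R)) (r : R) :
    algebraMap R L r * y ∈ functionalDual τ (ringLattice A L R) := by
  rintro _ ⟨r', rfl⟩
  have := hy (algebraMap R L (r * r')) ⟨r * r', rfl⟩
  convert this using 2
  change _ * algebraMap R L r' = _
  rw [map_mul (algebraMap R L)]
  ring

/-- The dual is an R-module, so the double dual multiplies it into itself. This makes the double
dual closed under multiplication. -/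
theorem mul_mem_functionalDual {τ : L →ₗ[K] K} {y k : L}
    (hy : y ∈ functionalDual τ (ringLattice A L R))
    (hk : k ∈ functionalDual τ (functionalDual τ (ringLattice A L R))) :
    k * y ∈ functionalDual τ (ringLattice A L R) := by
  rintro _ ⟨r, rfl⟩
  have := hk _ (mul_mem_functionalDual_ringLattice A hy r)
  convert this using 2
  change _ * algebraMap R L r = _
  ring

/-- The double dual of a ring in its fraction field is a ring. -/
def reflexiveHull (τ : L →ₗ[K] K) : Subalgebra R L where
  carrier := functionalDual τ (functionalDual τ (ringLattice A L R))
  add_mem' := add_mem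
  mul_mem' {k k'} hk hk' y hy := by
    rw [mul_assoc]
    exact hk _ (mul_mem_functionalDual A hy hk')
  algebraMap_mem' r y hy := by
    rw [mul_comm]
    exact hy _ ⟨r, rfl⟩

end

/-- A finite extension of a Noetherian domain is contained in a finite extension that is a second
syzygy over the base. -/
theorem exists_subalgebra_exact (A R : Type*) [CommRing A] [IsDomain A] [IsNoetherianRing A]
    [CommRing R] [IsDomain R] [Algebra A R] [FaithfulSMul A R] [Module.Finite A R] :
    ∃ S : Subalgebra R (FractionRing R), Module.Finite A S ∧
      ∃ (n t : ℕ) (i : S →ₗ[A] (Fin n → A)) (φ : (Fin n → A) →ₗ[A] (Fin t → A)),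
        Function.Injective i ∧ Function.Exact i φ := by
  let K := FractionRing A
  let L := FractionRing R
  let _ : Algebra K L := FractionRing.liftAlgebra A L
  have : IsScalarTower A K L := FractionRing.isScalarTower_liftAlgebra A L
  obtain ⟨τ, hτ⟩ : ∃ τ : L →ₗ[K] K, τ 1 ≠ 0 := by
    by_contra! h
    exact one_ne_zero ((Module.forall_dual_apply_eq_zero_iff K (1 : L)).mp h)
  have hRL := IsFractionRing.injective R L
  have hAK := IsFractionRing.injective A K
  have h1 : (ringLattice A L R).FG := by
    rw [ringLattice, LinearMap.range_eq_map]
    exact Module.Finite.fg_top.map _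
  have hn1 : ∀ l : L, l ≠ 0 → ∃ y ∈ ringLattice A L R, τ (l * y) ≠ 0 := by
    intro l hl
    obtain ⟨r, s, hs, hrs⟩ := IsFractionRing.div_surjective (A := R) l⁻¹
    obtain ⟨a, ha, s', hs'⟩ := (Algebra.IsAlgebraic.isAlgebraic (R := A) s).exists_nonzero_dvd hs
    refine ⟨algebraMap R L (r * s'), ⟨r * s', rfl⟩, ?_⟩
    have hs0 : algebraMap R L s ≠ 0 := by
      rw [Ne, map_eq_zero_iff _ hRL]
      exact nonZeroDivisors.ne_zero hs
    have h2 : l * algebraMap R L (r * s') = a • (1 : L) := by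
      rw [Algebra.smul_def, mul_one, IsScalarTower.algebraMap_apply A R L, hs', map_mul, map_mul,
        ← mul_assoc]
      congr 1
      rw [div_eq_iff hs0] at hrs
      rw [hrs, mul_inv_cancel_left₀ hl]
    rw [h2, LinearMap.map_smul_of_tower, Algebra.smul_def]
    exact mul_ne_zero ((map_ne_zero_iff _ hAK).mpr ha) hτ
  have h2 := (exists_exact_functionalDual h1 hn1).1
  have hn2 : ∀ l : L, l ≠ 0 → ∃ y ∈ functionalDual τ (ringLattice A L R), τ (l * y) ≠ 0 := by
    intro l hl
    obtain ⟨n, g, hg⟩ := Submodule.fg_iff_exists_fin_generating_family.mp h1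
    obtain ⟨⟨c, hc⟩, hcz⟩ := IsLocalization.exist_integer_multiples_of_finite (nonZeroDivisors A)
      (fun j => τ (l⁻¹ * g j))
    refine ⟨c • l⁻¹, ?_, ?_⟩
    · rw [← hg, mem_functionalDual_span, Set.forall_mem_range]
      intro j
      rw [smul_mul_assoc, LinearMap.map_smul_of_tower]
      exact hcz j
    · rw [mul_smul_comm, mul_inv_cancel₀ hl, LinearMap.map_smul_of_tower, Algebra.smul_def]
      exact mul_ne_zero ((map_ne_zero_iff _ hAK).mpr (nonZeroDivisors.ne_zero hc)) hτ
  obtain ⟨h3, n, i, hi, t, φ, hφ⟩ := exists_exact_functionalDual h2 hn2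
  exact ⟨reflexiveHull A τ, Module.Finite.iff_fg.mpr h3, n, t, i, φ, hi, hφ⟩

/-! ### Koszul exactness for a regular triple. -/

section

variable {A : Type*} [CommRing A]

theorem Ideal.IsRegularMod.pow {b : Ideal A} {t : A} (h : b.IsRegularMod t) (n : ℕ) :
    b.IsRegularMod (t ^ n) := by
  induction n with
  | zero => exact fun r hr => by simpa using hr
  | succ n ih => exact fun r hr => ih r (h _ (by rwa [← mul_assoc, ← pow_succ']))

theorem Ideal.IsRegularMod.sup_span_pow {b : Ideal A} {s t : A} (hs : b.IsRegularMod s)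
    (h : (b ⊔ Ideal.span {s}).IsRegularMod t) (n : ℕ) :
    (b ⊔ Ideal.span {s ^ n}).IsRegularMod t := by
  induction n with
  | zero =>
    intro r _
    rw [pow_zero, Ideal.span_singleton_one, sup_top_eq]
    trivial
  | succ n ih =>
    intro r hr
    obtain ⟨w, hw⟩ := Ideal.mem_sup_span_singleton_iff.mp hr
    obtain ⟨r', hr'⟩ := Ideal.mem_sup_span_singleton_iff.mp (h r
      (Ideal.mem_sup_span_singleton_iff.mpr ⟨s ^ n * w, by rwa [← mul_assoc, ← pow_succ']⟩))
    obtain ⟨v, hv⟩ := Ideal.mem_sup_span_singleton_iff.mp (ih r'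
      (Ideal.mem_sup_span_singleton_iff.mpr ⟨w, hs _ (by
        convert Ideal.sub_mem _ hw (b.mul_mem_left t hr') using 1
        ring)⟩))
    refine Ideal.mem_sup_span_singleton_iff.mpr ⟨v, ?_⟩
    convert Ideal.add_mem _ hr' (b.mul_mem_left s hv) using 1
    ring

/-- A weakly regular sequence of length three. -/
structure IsRegularTriple (a : Fin 3 → A) : Prop where
  zero : (⊥ : Ideal A).IsRegularMod (a 0)
  one : (⊥ ⊔ Ideal.span {a 0}).IsRegularMod (a 1)
  two : (⊥ ⊔ Ideal.span {a 0} ⊔ Ideal.span {a 1}).IsRegularMod (a 2)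

theorem IsRegularTriple.pow {a : Fin 3 → A} (h : IsRegularTriple a) (n : ℕ) :
    IsRegularTriple (a ^ n) := by
  refine ⟨h.zero.pow n, (h.zero.sup_span_pow h.one n).pow n, ?_⟩
  have h1 := (h.one.sup_span_pow h.two n).pow n
  rw [sup_right_comm] at h1 ⊢
  exact (h.zero.swap (h.one.pow n)).sup_span_pow h1 n

/-- Exactness of the Koszul complex in degree one; it glues fractions h_j / b_j that agree on
overlaps. -/
theorem IsRegularTriple.exists_mul_eq {b : Fin 3 → A} (hb : IsRegularTriple b) {h : Fin 3 → A}
    (hh : ∀ j k, b k * h j = b j * h k) : ∃ c, ∀ j, h j = b j * c := by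
  obtain ⟨c, hc⟩ := Ideal.mem_sup_span_singleton_iff.mp (hb.one (h 0)
    (Ideal.mem_sup_span_singleton_iff.mpr ⟨h 1, by rw [hh 0 1, sub_self]; exact zero_mem _⟩))
  rw [Ideal.mem_bot, sub_eq_zero] at hc
  refine ⟨c, fun j => sub_eq_zero.mp (hb.zero _ ?_)⟩
  rw [Ideal.mem_bot, mul_sub, ← hh 0 j, hc]
  ring

/-- Exactness of the Koszul complex in degree two, the place where the third regular element is
used. It makes Čech 1-cocycles with values in a free module coboundaries. -/
theorem IsRegularTriple.exists_eq_sub {b : Fin 3 → A} (hb : IsRegularTriple b)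
    {w : Fin 3 → Fin 3 → A} (hw : ∀ j, w j j = 0) (hw' : ∀ j k, w j k = - w k j)
    (hc : ∀ i j k, b k * w i j - b j * w i k + b i * w j k = 0) :
    ∃ h : Fin 3 → A, ∀ j k, w j k = b k * h j - b j * h k := by
  have h012 := hc 0 1 2
  obtain ⟨h0, hh⟩ := Ideal.mem_sup_span_singleton_iff.mp (hb.two (w 0 1)
    (Ideal.mem_sup_span_singleton_iff.mpr ⟨w 0 2, Ideal.mem_sup_span_singleton_iff.mpr
      ⟨- w 1 2, by rw [Ideal.mem_bot]; linear_combination h012⟩⟩))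
  obtain ⟨h1, h01⟩ := Ideal.mem_sup_span_singleton_iff.mp hh
  rw [Ideal.mem_bot] at h01
  obtain ⟨h2, h02⟩ := Ideal.mem_sup_span_singleton_iff.mp (hb.one (w 0 2 - b 2 * h0)
    (Ideal.mem_sup_span_singleton_iff.mpr ⟨w 1 2 + b 2 * h1, by
      rw [Ideal.mem_bot]; linear_combination b 2 * h01 - h012⟩))
  rw [Ideal.mem_bot] at h02
  have h12 : w 1 2 + b 2 * h1 - b 1 * h2 = 0 := by
    refine hb.zero _ ?_
    rw [Ideal.mem_bot]
    linear_combination h012 + b 1 * h02 - b 2 * h01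
  have key : ∀ j k, j < k → w j k = b k * ![h0, -h1, -h2] j - b j * ![h0, -h1, -h2] k := by
    intro j k hjk
    fin_cases j <;> fin_cases k <;> first
      | exact absurd hjk (by decide)
      | skip
    · change w 0 1 = b 1 * h0 - b 0 * -h1
      linear_combination h01
    · change w 0 2 = b 2 * h0 - b 0 * -h2
      linear_combination h02
    · change w 1 2 = b 2 * -h1 - b 1 * -h2
      linear_combination h12
  refine ⟨![h0, -h1, -h2], fun j k => ?_⟩
  rcases lt_trichotomy j k with hjk | rfl | hjk
  · exact key j k hjk
  · rw [hw, sub_self]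
  · rw [hw', key k j hjk, neg_sub]

variable {n : ℕ}

theorem IsRegularTriple.exists_smul_eq {b : Fin 3 → A} (hb : IsRegularTriple b)
    {h : Fin 3 → Fin n → A} (hh : ∀ j k, b k • h j = b j • h k) : ∃ c, ∀ j, h j = b j • c := by
  choose c hc using fun l => hb.exists_mul_eq (h := fun j => h j l)
    (fun j k => congrFun (hh j k) l)
  exact ⟨c, fun j => funext fun l => hc l j⟩

theorem IsRegularTriple.exists_eq_smul_sub {b : Fin 3 → A} (hb : IsRegularTriple b)
    {w : Fin 3 → Fin 3 → Fin n → A} (hw : ∀ j, w j j = 0) (hw' : ∀ j k, w j k = - w k j)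
    (hc : ∀ i j k, b k • w i j - b j • w i k + b i • w j k = 0) :
    ∃ h : Fin 3 → Fin n → A, ∀ j k, w j k = b k • h j - b j • h k := by
  choose c hc using fun l => hb.exists_eq_sub (w := fun j k => w j k l)
    (fun j => congrFun (hw j) l) (fun j k => congrFun (hw' j k) l)
    (fun i j k => congrFun (hc i j k) l)
  exact ⟨fun j l => c l j, fun j k => funext fun l => hc l j k⟩

theorem IsRegularTriple.eq_zero_of_smul {b : Fin 3 → A} (hb : IsRegularTriple b)
    {v : Fin n → A} (h : b 0 • v = 0) : v = 0 :=
  funext fun l => hb.zero _ (congrFun h l)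

end

/-! ### The Čech obstruction to lifting from x = 0. -/

section

variable {A S : Type*} [CommRing A] [CommRing S] [Algebra A S] {n t : ℕ}

/-- The Čech cocycle of the syzygy module defined by `η` lifts to a coboundary after multiplication
by `x ^ m`, at the level `N` of denominators. -/
def IsCechTorsion (i : S →ₗ[A] (Fin n → A)) (φ : (Fin n → A) →ₗ[A] (Fin t → A)) (a : Fin 3 → A)
    (x : S) (m : ℕ) (η : Fin t → A) (N : ℕ) : Prop :=
  ∃ (h : Fin 3 → Fin n → A) (s : Fin 3 → S) (w : Fin 3 → Fin 3 → S),
    (∀ k, φ (h k) = a k ^ N • η) ∧ (∀ j k, i (w j k) = a k ^ N • h j - a j ^ N • h k) ∧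
      ∀ j k, x ^ m * w j k = a k ^ N • s j - a j ^ N • s k

variable {i : S →ₗ[A] (Fin n → A)} {φ : (Fin n → A) →ₗ[A] (Fin t → A)} {a : Fin 3 → A}
  {x : S} {m : ℕ} {η : Fin t → A} {N : ℕ}

theorem IsCechTorsion.add_right (h : IsCechTorsion i φ a x m η N) (M : ℕ) :
    IsCechTorsion i φ a x m η (N + M) := by
  obtain ⟨h, s, w, h1, h2, h3⟩ := h
  refine ⟨fun k => a k ^ M • h k, fun k => a k ^ M • s k, fun j k => (a j ^ M * a k ^ M) • w j k,
    fun k => ?_, fun j k => ?_, fun j k => ?_⟩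
  · rw [map_smul, h1, smul_smul, pow_add, mul_comm]
  · rw [map_smul, h2]
    module
  · rw [mul_smul_comm, h3]
    module

theorem IsCechTorsion.succ (h : IsCechTorsion i φ a x m η N) :
    IsCechTorsion i φ a x (m + 1) η N := by
  obtain ⟨h, s, w, h1, h2, h3⟩ := h
  refine ⟨h, fun k => x * s k, w, h1, h2, fun j k => ?_⟩
  rw [pow_succ', mul_assoc, h3, mul_sub, mul_smul_comm, mul_smul_comm]

variable (i φ a x m)

/-- The submodule of those `η` whose Čech cocycle is killed by `x ^ m`. -/
def cechTorsion : Submodule A (Fin t → A) where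
  carrier := {η | ∃ N, IsCechTorsion i φ a x m η N}
  add_mem' := by
    rintro η η' ⟨N, hN⟩ ⟨N', hN'⟩
    obtain ⟨h, s, w, h1, h2, h3⟩ := hN.add_right N'
    have := hN'.add_right N
    rw [add_comm] at this
    obtain ⟨h', s', w', h1', h2', h3'⟩ := this
    refine ⟨N + N', h + h', s + s', w + w', fun k => ?_, fun j k => ?_, fun j k => ?_⟩
    · rw [Pi.add_apply, map_add, h1, h1', smul_add]
    · simp only [Pi.add_apply, map_add, h2, h2']
      module
    · simp only [Pi.add_apply, mul_add, h3, h3']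
      module
  zero_mem' := ⟨0, 0, 0, 0, by simp, by simp, by simp⟩
  smul_mem' := by
    rintro c η ⟨N, h, s, w, h1, h2, h3⟩
    refine ⟨N, c • h, c • s, c • w, fun k => ?_, fun j k => ?_, fun j k => ?_⟩
    · rw [Pi.smul_apply, map_smul, h1, smul_comm]
    · simp only [Pi.smul_apply, map_smul, h2]
      module
    · simp only [Pi.smul_apply, mul_smul_comm, h3]
      module

/-- Recording obstructions by vectors in A^t, rather than by cohomology classes, turns the x-power
torsion into an ascending chain in a Noetherian module. -/
theorem exists_cechTorsion_succ_le [IsNoetherianRing A] :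
    ∃ m, cechTorsion i φ a x (m + 1) ≤ cechTorsion i φ a x m := by
  obtain ⟨m, hm⟩ := monotone_stabilizes_iff_noetherian.mpr
    (inferInstance : IsNoetherian A (Fin t → A))
    ⟨cechTorsion i φ a x, monotone_nat_of_le_succ fun m η ⟨N, hN⟩ => ⟨N, hN.succ⟩⟩
  exact ⟨m, (hm (m + 1) (Nat.le_succ m)).ge⟩

variable {i φ a x m}

/-- If `u` is a Čech cocycle modulo a high power of `x`, then some multiple of `u` is modulo `x` the
restriction of an element of the ring. -/
theorem exists_smul_eq_sub (hi : Function.Injective i) (hφ : Function.Exact i φ)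
    (ha : IsRegularTriple a) (hx : x ∈ nonZeroDivisors S)
    (hm : cechTorsion i φ a x (m + 1) ≤ cechTorsion i φ a x m) {u : Fin 3 → S}
    (hu : ∀ j k, x ^ (m + 1) ∣ a k ^ N • u j - a j ^ N • u k) :
    ∃ (f : S) (M : ℕ) (s : Fin 3 → S), ∀ k, a k ^ (N + M) • f = a k ^ M • u k - x * s k := by
  have hcancel : ∀ y z : S, x ^ (m + 1) * y = x ^ (m + 1) * z → y = z := fun y z h =>
    (mul_cancel_left_mem_nonZeroDivisors (pow_mem hx (m + 1))).mp h
  -- w is the connecting homomorphism applied to u: a cocycle in S whose product with x^(m+1) is the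
  -- coboundary of u. In A^n it becomes the coboundary of some h, and the φ(h_k) glue to η.
  choose w hw using hu
  have hb := ha.pow N
  obtain ⟨h, hh⟩ := hb.exists_eq_smul_sub (w := fun j k => i (w j k))
    (fun j => by
      rw [← map_zero i]
      refine congrArg i (hcancel _ _ ?_)
      rw [← hw, sub_self, mul_zero])
    (fun j k => by
      rw [← map_neg i]
      refine congrArg i (hcancel _ _ ?_)
      rw [← hw, mul_neg, ← hw, neg_sub])
    (fun p j k => by
      rw [← map_smul, ← map_smul, ← map_smul, ← map_sub, ← map_add, ← map_zero i]
      refine congrArg i (hcancel _ _ ?_)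
      simp only [mul_add, mul_sub, mul_smul_comm, ← hw, Pi.pow_apply, mul_zero]
      module)
  obtain ⟨η, hη⟩ := hb.exists_smul_eq (h := fun j => φ (h j)) (fun j k => by
    rw [← sub_eq_zero, ← map_smul, ← map_smul, ← map_sub, ← hh]
    exact hφ.apply_apply_eq_zero _)
  obtain ⟨M, hM⟩ := hm (show η ∈ cechTorsion i φ a x (m + 1) from
    ⟨N, h, u, w, hη, hh, fun j k => (hw j k).symm⟩)
  have hM' := hM.add_right N
  rw [add_comm] at hM'
  obtain ⟨h', s', w', h1, h2, h3⟩ := hM'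
  -- Both a_k^M h_k and h'_k lift a_k^(N+M) η, so they differ by an element of S.
  have hσ : ∀ k, ∃ σ, i σ = a k ^ M • h k - h' k := fun k => by
    refine (hφ _).mp ?_
    rw [map_sub, map_smul, h1, hη, Pi.pow_apply, smul_smul, pow_add, mul_comm, sub_self]
  choose σ hσ using hσ
  have hww : ∀ j k, (a j ^ M * a k ^ M) • w j k - w' j k =
      a k ^ (N + M) • σ j - a j ^ (N + M) • σ k := fun j k => hi (by
    simp only [map_sub, map_smul, h2, hσ, hh, Pi.pow_apply]
    module)
  -- Corrected by multiples of x, the local functions agree exactly on overlaps, so they glue to a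
  -- vector ζ. It comes from S because φ(ζ) is killed by the regular element a_0^(N+M).
  have hv : ∀ j k, a k ^ (N + M) • (a j ^ M • u j - x * (s' j + x ^ m * σ j)) =
      a j ^ (N + M) • (a k ^ M • u k - x * (s' k + x ^ m * σ k)) := fun j k => by
    have e1 := hw j k
    have e2 := h3 j k
    have e3 := hww j k
    simp only [Algebra.smul_def, map_mul, map_pow] at e1 e2 e3 ⊢
    linear_combination algebraMap A S (a j) ^ M * algebraMap A S (a k) ^ M * e1 + x * e2 +
      x ^ (m + 1) * e3
  have hbM := ha.pow (N + M)
  obtain ⟨ζ, hζ⟩ := hbM.exists_smul_eq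
    (h := fun j => i (a j ^ M • u j - x * (s' j + x ^ m * σ j))) (fun j k => by
      rw [← map_smul, ← map_smul]
      exact congrArg i (hv j k))
  obtain ⟨f, rfl⟩ := (hφ ζ).mp (hbM.eq_zero_of_smul (by
    rw [← map_smul, ← hζ]
    exact hφ.apply_apply_eq_zero _))
  refine ⟨f, M, fun k => s' k + x ^ m * σ k, fun k => hi ?_⟩
  rw [hζ k, map_smul]
  rfl

/-- A splitting of the locus `x = 0` into the loci of `I` and `J` away from the locus of a
regular sequence in `I ⊔ J` is given by an element of the ring. -/
theorem exists_separating_element [IsNoetherianRing A] (hi : Function.Injective i)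
    (hφ : Function.Exact i φ) (ha : IsRegularTriple a) (hx : x ∈ nonZeroDivisors S)
    {I J : Ideal S} {e : ℕ} (hIJ : (I * J) ^ e ≤ Ideal.span {x})
    (haIJ : ∀ k, algebraMap A S (a k) ∈ I ⊔ J) :
    ∃ f : S, (∀ P : Ideal S, P.IsPrime → J ≤ P → x ∈ P → (∃ k, algebraMap A S (a k) ∉ P) → f ∈ P) ∧
      ∀ P : Ideal S, P.IsPrime → I ≤ P → x ∈ P → (∃ k, algebraMap A S (a k) ∉ P) →
        1 - f ∈ P := by
  obtain ⟨m, hm⟩ := exists_cechTorsion_succ_le i φ a x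
  -- The summand 1 makes the exponent nonzero, so that K^e' ≤ K for every ideal K.
  let e' := e * (m + 1) + 1
  have he' : (I * J) ^ e' ≤ Ideal.span {x ^ (m + 1)} := by
    refine (Ideal.pow_le_pow_right (Nat.le_succ _)).trans ?_
    rw [pow_mul, ← Ideal.span_singleton_pow]
    exact Ideal.pow_right_mono hIJ _
  -- By (I + J)^(2e') ≤ I^e' + J^e', the fraction u_k / a_k^(2e') is 0 on the locus of J and 1 on
  -- that of I. Its failure to be a cocycle lies in (IJ)^e'.
  have hdec : ∀ k, ∃ u ∈ J ^ e', algebraMap A S (a k) ^ (e' + e') - u ∈ I ^ e' := fun k => by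
    obtain ⟨v, hv, u, hu, huv⟩ := Submodule.mem_sup.mp
      (Ideal.sup_pow_add_le_pow_sup_pow (Ideal.pow_mem_pow (haIJ k) (e' + e')))
    exact ⟨u, hu, by rwa [← huv, add_sub_cancel_right]⟩
  choose u hu hu' using hdec
  obtain ⟨f, M, s, hf⟩ := exists_smul_eq_sub hi hφ ha hx hm (N := e' + e') (u := u) (fun j k => by
    rw [← Ideal.mem_span_singleton]
    refine he' ?_
    rw [mul_pow]
    have : a k ^ (e' + e') • u j - a j ^ (e' + e') • u k =
        (algebraMap A S (a k) ^ (e' + e') - u k) * u j -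
          (algebraMap A S (a j) ^ (e' + e') - u j) * u k := by
      simp only [Algebra.smul_def, map_pow]
      ring
    rw [this]
    exact sub_mem (Ideal.mul_mem_mul (hu' k) (hu j)) (Ideal.mul_mem_mul (hu' j) (hu k)))
  simp only [Algebra.smul_def, map_pow] at hf
  have hpow : ∀ K : Ideal S, K ^ e' ≤ K := fun K => Ideal.pow_le_self (Nat.succ_ne_zero _)
  refine ⟨f, fun P hP hJ hxP ⟨k, hk⟩ => ?_, fun P hP hI hxP ⟨k, hk⟩ => ?_⟩
  · refine (hP.mem_or_mem (x := algebraMap A S (a k) ^ (e' + e' + M)) ?_).resolve_left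
      fun h => hk (hP.mem_of_pow_mem _ h)
    rw [hf]
    exact sub_mem (P.mul_mem_left _ (hJ (hpow _ (hu k)))) (P.mul_mem_right _ hxP)
  · refine (hP.mem_or_mem (x := algebraMap A S (a k) ^ (e' + e' + M)) ?_).resolve_left
      fun h => hk (hP.mem_of_pow_mem _ h)
    have : algebraMap A S (a k) ^ (e' + e' + M) * (1 - f) =
        algebraMap A S (a k) ^ M * (algebraMap A S (a k) ^ (e' + e') - u k) + x * s k := by
      rw [mul_sub, hf]
      ring
    rw [this]
    exact add_mem (P.mul_mem_left _ (hI (hpow _ (hu' k)))) (P.mul_mem_right _ hxP)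

end

/-! ### Finite domains over complete local rings. -/

theorem IsPrecomplete.of_finite {R : Type*} [CommRing R] (I : Ideal R) [IsPrecomplete I R]
    (M : Type*) [AddCommGroup M] [Module R M] [Module.Finite R M] : IsPrecomplete I M := by
  rw [← AdicCompletion.of_surjective_iff, ← LinearMap.range_eq_top, eq_top_iff]
  rintro y -
  obtain ⟨z, rfl⟩ := AdicCompletion.ofTensorProduct_surjective_of_finite I M y
  induction z using TensorProduct.induction_on with
  | zero => rw [map_zero]; exact zero_mem _
  | add z z' h h' => rw [map_add]; exact add_mem h h'
  | tmul r m =>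
    obtain ⟨r, rfl⟩ := AdicCompletion.of_surjective I R r
    refine ⟨r • m, ?_⟩
    rw [AdicCompletion.ofTensorProduct_tmul, map_smul]
    ext n
    simp only [AdicCompletion.val_smul_apply, AdicCompletion.smul_eval, AdicCompletion.of_apply]
    rfl

/-- The Artinian quotient of S by the extended maximal ideal contains an idempotent attached to the
image of f. It lifts by Hensel's lemma for X² - X, and the only idempotents of the domain S are 0
and 1. -/
theorem isUnit_or_isUnit_one_sub_of_finite (R S : Type*) [CommRing R] [IsLocalRing R]
    [IsNoetherianRing R] [IsAdicComplete (maximalIdeal R) R] [CommRing S] [IsDomain S]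
    [Algebra R S] [Module.Finite R S] (f : S) : IsUnit f ∨ IsUnit (1 - f) := by
  let I := (maximalIdeal R).map (algebraMap R S)
  have : IsPrecomplete (maximalIdeal R) S := .of_finite _ _
  have : IsAdicComplete (maximalIdeal R) S := {}
  have : IsAdicComplete I S :=
    { IsHausdorff.map_algebraMap_iff.mpr inferInstance,
      IsPrecomplete.map_algebraMap_iff.mpr inferInstance with }
  let B := S ⧸ I
  let _ : Field (R ⧸ maximalIdeal R) := Ideal.Quotient.field _
  have : IsArtinianRing B := .of_finite (R ⧸ maximalIdeal R) B
  have hunit : ∀ s : S, IsUnit (Ideal.Quotient.mk I s) → IsUnit s := fun s hs => by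
    have := isLocalHom_of_le_jacobson_bot I (IsAdicComplete.le_jacobson_bot I)
    exact isUnit_of_map_unit _ _ hs
  let g : B := Ideal.Quotient.mk I f
  obtain ⟨n, c, hc⟩ := IsArtinian.exists_pow_succ_smul_dvd g (1 : B)
  simp only [smul_eq_mul, mul_one] at hc
  have hc' : ∀ k, g ^ (n + k) * c ^ k = g ^ n := fun k => by
    induction k with
    | zero => simp
    | succ k ih =>
      rw [pow_succ] at hc
      linear_combination g ^ k * c ^ k * hc + ih
  have hid : (g ^ n * c ^ n) * (g ^ n * c ^ n) = g ^ n * c ^ n := by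
    conv_rhs => rw [← hc' n]
    ring
  obtain ⟨b, hb⟩ := Ideal.Quotient.mk_surjective (g ^ n * c ^ n)
  obtain ⟨a, ha, hab⟩ := HenselianRing.is_henselian (I := I) (Polynomial.X ^ 2 - Polynomial.X)
    (by monicity!) b (by
      rw [← Ideal.Quotient.eq_zero_iff_mem]
      simp [hb, hid, pow_two]) (by
      refine IsUnit.of_mul_eq_one (Ideal.Quotient.mk I (2 * b - 1)) ?_
      simp only [Polynomial.derivative_sub, Polynomial.derivative_X_pow, Polynomial.derivative_X]
      simp only [Polynomial.eval_sub, Polynomial.eval_mul, Polynomial.eval_pow, Polynomial.eval_X,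
        Polynomial.eval_one]
      simp [hb]
      rw [map_ofNat]
      linear_combination 4 * hid)
  have hab' : Ideal.Quotient.mk I a = g ^ n * c ^ n := by
    rw [← hb]
    exact Ideal.Quotient.eq.mpr hab
  have ha' : a * (a - 1) = 0 := by
    have := ha.eq_zero
    simp only [Polynomial.eval_sub, Polynomial.eval_pow, Polynomial.eval_X] at this
    linear_combination this
  rcases mul_eq_zero.mp ha' with rfl | h1
  · right
    refine hunit _ ?_
    have hg : g ^ n = 0 := by
      rw [← hc' n, pow_add, mul_assoc, ← hab', map_zero, mul_zero]
    rw [map_sub, map_one]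
    exact (show IsNilpotent g from ⟨n, hg⟩).isUnit_one_sub
  · left
    refine hunit _ ?_
    rw [sub_eq_zero.mp h1, map_one] at hab'
    rw [pow_succ] at hc
    exact IsUnit.of_mul_eq_one c (by linear_combination c ^ n * hc + (g * c - 1) * hab')

/-! ### Dimension inequalities. -/

theorem exists_natCast_eq_of_le {a : WithBot ℕ∞} {d : ℕ} (h0 : 0 ≤ a) (h : a ≤ d) :
    ∃ n : ℕ, a = n := by
  induction a using WithBot.recBotCoe with
  | bot => simp at h0
  | coe a =>
    obtain ⟨n, hn⟩ := ENat.ne_top_iff_exists.mp (show a ≠ ⊤ by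
      rintro rfl
      exact absurd (WithBot.coe_le_coe.mp h) (by simp))
    exact ⟨n, by rw [← hn]; rfl⟩

theorem RingHom.IsIntegral.ringKrullDim_eq {A B : Type*} [CommRing A] [CommRing B] {f : A →+* B}
    (hf : f.IsIntegral) (hinj : Function.Injective f) : ringKrullDim B = ringKrullDim A := by
  algebraize [f]
  have : FaithfulSMul A B := (faithfulSMul_iff_algebraMap_injective A B).mpr hinj
  refine le_antisymm (Order.krullDim_le_of_strictMono (PrimeSpectrum.comap (algebraMap A B))
    fun P Q h => Ideal.IsIntegral.comap_lt_comap (R := A) h) ?_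
  refine iSup_le fun l => ?_
  obtain ⟨⟨P, hP⟩, hPl⟩ := Algebra.IsIntegral.comap_surjective A B l.head
  have : P.LiesOver l.head.asIdeal := ⟨by rw [← hPl]; rfl⟩
  obtain ⟨L, hL, -⟩ := Ideal.exists_ltSeries_of_hasGoingUp l P
  rw [← hL]
  exact Order.LTSeries.length_le_krullDim L

theorem ringKrullDim_quotient_comap {A B : Type*} [CommRing A] [CommRing B] [Algebra A B]
    [Algebra.IsIntegral A B] (P : Ideal B) :
    ringKrullDim (A ⧸ P.comap (algebraMap A B)) = ringKrullDim (B ⧸ P) :=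
  (RingHom.IsIntegral.ringKrullDim_eq (f := Ideal.quotientMap P (algebraMap A B) le_rfl)
    (RingHom.IsIntegral.quotient _ (algebraMap_isIntegral_iff.mpr inferInstance))
    Ideal.quotientMap_injective).symm

theorem ringKrullDim_quotient_succ_le_of_lt {B : Type*} [CommRing B] {P Q : Ideal B} [P.IsPrime]
    (h : P < Q) : ringKrullDim (B ⧸ Q) + 1 ≤ ringKrullDim (B ⧸ P) := by
  obtain ⟨hle, r, hrQ, hrP⟩ := SetLike.lt_iff_le_and_exists.mp h
  refine ringKrullDim_succ_le_of_surjective (Ideal.Quotient.factor hle)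
    (Ideal.Quotient.factor_surjective hle) (r := Ideal.Quotient.mk P r) ?_ ?_
  · rw [mem_nonZeroDivisors_iff_ne_zero, Ne, Ideal.Quotient.eq_zero_iff_mem]
    exact hrP
  · rw [Ideal.Quotient.factor_mk, Ideal.Quotient.eq_zero_iff_mem]
    exact hrQ

theorem ringKrullDim_quotient_add_two_le_of_two_le_height {B : Type*} [CommRing B] {P : Ideal B}
    [P.IsPrime] (h : 2 ≤ P.height) : ringKrullDim (B ⧸ P) + 2 ≤ ringKrullDim B := by
  obtain ⟨Q, hQ, hQP, hQ0⟩ : ∃ Q : Ideal B, Q.IsPrime ∧ Q < P ∧ Q.height ≠ 0 := by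
    by_contra! hcon
    have : P.height ≤ (1 : ℕ) := Ideal.height_le_iff.mpr fun q hq hqp => by
      rw [hcon q hq hqp]
      exact zero_lt_one
    exact absurd (h.trans this) (by decide)
  obtain ⟨Q', hQ', hQQ'⟩ := Ideal.exists_minimalPrimes_le (I := ⊥) (J := Q) bot_le
  have hlt : Q' < Q := lt_of_le_of_ne hQQ' fun h => hQ0 (Ideal.height_eq_zero_iff.mpr (h ▸ hQ'))
  have := hQ'.1.1
  calc ringKrullDim (B ⧸ P) + 2 = ringKrullDim (B ⧸ P) + 1 + 1 := by rw [add_assoc]; norm_num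
    _ ≤ ringKrullDim (B ⧸ Q) + 1 := by gcongr; exact ringKrullDim_quotient_succ_le_of_lt hQP
    _ ≤ ringKrullDim (B ⧸ Q') := ringKrullDim_quotient_succ_le_of_lt hlt
    _ ≤ ringKrullDim B := ringKrullDim_quotient_le _

/-! ### Systems of parameters and Noether normalization. -/

section

variable (R : Type*) [CommRing R] [IsLocalRing R] [IsNoetherianRing R]

theorem exists_systemOfParameters {d : ℕ} (hd : ringKrullDim R = d) :
    ∃ y : Fin d → R, (∀ i, y i ∈ maximalIdeal R) ∧
      ∃ e, maximalIdeal R ^ e ≤ Ideal.span (Set.range y) := by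
  obtain ⟨s, hs, hcard⟩ := (maximalIdeal R).exists_finset_card_eq_height_of_isNoetherianRing
  have hsd : s.card = d := by
    have := maximalIdeal_height_eq_ringKrullDim (R := R)
    rw [← hcard, hd] at this
    exact_mod_cast this
  subst hsd
  have hrange : Set.range (fun i => (s.equivFin.symm i : R)) = s := by
    ext z
    refine ⟨?_, fun hz => ⟨s.equivFin ⟨z, hz⟩, by simp⟩⟩
    rintro ⟨i, rfl⟩
    exact (s.equivFin.symm i).2
  refine ⟨fun i => s.equivFin.symm i, fun i => hs.1.2 (Ideal.subset_span (s.equivFin.symm i).2), ?_⟩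
  rw [hrange]
  refine Ideal.exists_pow_le_of_le_radical_of_fg ?_ (IsNoetherian.noetherian _)
  rw [Ideal.radical_eq_sInf]
  refine le_sInf fun P ⟨hP, hPp⟩ => hs.2 ⟨hPp, hP⟩ (le_maximalIdeal hPp.ne_top)

variable [IsDomain R]

theorem exists_systemOfParameters_natCast {d : ℕ} (hd : ringKrullDim R = d) :
    ∃ y : Fin d → R, (∀ i, y i ∈ maximalIdeal R) ∧
      (∃ e, maximalIdeal R ^ e ≤ Ideal.span (Set.range y)) ∧
      ∀ n : ℕ, (n : ResidueField R) = 0 → ∃ a : Fin d → ℕ, (n : R) = ∑ i, (a i : R) * y i := by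
  obtain ⟨p, hp⟩ := CharP.exists (ResidueField R)
  -- Any parameters work in equal characteristic, including p = 0. In mixed characteristic p itself
  -- is taken as the first parameter.
  by_cases hpR : (p : R) = 0
  · obtain ⟨y, hy, he⟩ := exists_systemOfParameters R hd
    refine ⟨y, hy, he, fun n hn => ⟨0, ?_⟩⟩
    obtain ⟨k, rfl⟩ := (CharP.cast_eq_zero_iff _ p n).mp hn
    simp [hpR]
  have hpm : (p : R) ∈ maximalIdeal R := by
    rw [← residue_eq_zero_iff, map_natCast]
    exact CharP.cast_eq_zero _ p
  let I := Ideal.span {(p : R)}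
  have hI : I ≠ ⊤ := fun h =>
    (mem_maximalIdeal _).mp hpm (Ideal.span_singleton_eq_top.mp h)
  have hdim := ringKrullDim_quotient_span_singleton_succ_eq_ringKrullDim_of_mem_nonZeroDivisors
    (mem_nonZeroDivisors_of_ne_zero hpR) hpm
  have : Nontrivial (R ⧸ I) := Ideal.Quotient.nontrivial_iff.mpr hI
  have : IsLocalRing (R ⧸ I) := .of_surjective' (Ideal.Quotient.mk I) Ideal.Quotient.mk_surjective
  obtain ⟨d', hd'⟩ : ∃ d' : ℕ, ringKrullDim (R ⧸ I) = d' := by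
    refine exists_natCast_eq_of_le (d := d) ringKrullDim_nonneg_of_nontrivial ?_
    rw [← hd]
    exact ringKrullDim_quotient_le _
  obtain rfl : d = d' + 1 := by
    rw [hd, hd'] at hdim
    exact_mod_cast hdim.symm
  obtain ⟨y, hy, e, he⟩ := exists_systemOfParameters (R ⧸ I) hd'
  choose z hz using fun i => Ideal.Quotient.mk_surjective (y i)
  have := IsLocalHom.of_surjective (Ideal.Quotient.mk I) Ideal.Quotient.mk_surjective
  refine ⟨Fin.cons p z, fun i => ?_, ⟨e, fun r hr => ?_⟩, fun n hn => ?_⟩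
  · induction i using Fin.cases with
    | zero => exact hpm
    | succ i =>
      rw [Fin.cons_succ, mem_maximalIdeal, mem_nonunits_iff, ← isUnit_map_iff (Ideal.Quotient.mk I),
        hz]
      exact hy i
  · have h1 : Ideal.Quotient.mk I r ∈ Ideal.span (Set.range y) := by
      refine he ?_
      have := Ideal.mem_map_of_mem (Ideal.Quotient.mk I) hr
      rw [Ideal.map_pow] at this
      refine Ideal.pow_right_mono (Ideal.map_le_iff_le_comap.mpr fun r hr => ?_) e this
      rw [mem_maximalIdeal, mem_nonunits_iff] at hr
      rwa [Ideal.mem_comap, mem_maximalIdeal, mem_nonunits_iff, isUnit_map_iff]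
    obtain ⟨c, hc⟩ := Ideal.mem_span_range_iff_exists_fun.mp h1
    choose b hb using fun i => Ideal.Quotient.mk_surjective (c i)
    have h2 : r - ∑ i, b i * z i ∈ I := by
      rw [← Ideal.Quotient.eq_zero_iff_mem, map_sub, map_sum, ← hc]
      simp [hb, hz]
    obtain ⟨b0, hb0⟩ := Ideal.mem_span_singleton'.mp h2
    refine Ideal.mem_span_range_iff_exists_fun.mpr ⟨Fin.cons b0 b, ?_⟩
    rw [Fin.sum_univ_succ]
    simp [hb0]
  · obtain ⟨k, rfl⟩ := (CharP.cast_eq_zero_iff _ p n).mp hn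
    refine ⟨Fin.cons k 0, ?_⟩
    rw [Fin.sum_univ_succ]
    simp [mul_comm]

/-- Noether normalization: a complete Noetherian local domain is a finite extension of a Noetherian
local domain of full depth. -/
theorem exists_subring_finite_depthGE [IsAdicComplete (maximalIdeal R) R] {d : ℕ}
    (hd : ringKrullDim R = d) : ∃ A : Subring R, Module.Finite A R ∧ IsNoetherianRing A ∧
      ∃ _ : IsLocalRing A, (⊥ : Ideal A).DepthGE d := by
  obtain ⟨x, hx, ⟨e, he⟩, hchar⟩ := exists_systemOfParameters_natCast R hd
  obtain ⟨A, hfin, hnoeth, hloc, y, hy⟩ :=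
    exists_subring_finite_maximalIdeal_eq_span x hx e he hchar
  refine ⟨A, hfin, hnoeth, hloc, (isDomain_and_depthGE_of_maximalIdeal_eq_span ?_ y hy).2⟩
  rw [← hd]
  exact (RingHom.IsIntegral.ringKrullDim_eq (f := algebraMap A R)
    (algebraMap_isIntegral_iff.mpr inferInstance) Subtype.val_injective).le

end

/-! ### Dimension of the components of x = 0 and the contradiction. -/

theorem Ideal.isAssociatedTo_of_mem_minimalPrimes {S : Type*} [CommRing S] [IsNoetherianRing S]
    {b P : Ideal S} (hP : P ∈ b.minimalPrimes) : b.IsAssociatedTo P := by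
  rw [Ideal.isAssociatedTo_iff]
  refine Module.associatedPrimes.minimalPrimes_annihilator_subset_associatedPrimes S (S ⧸ b) ?_
  rwa [Ideal.annihilator_quotient]

section

variable {A R : Type*} [CommRing A] [IsDomain A] [IsNoetherianRing A] [IsLocalRing A]
  [CommRing R] [IsDomain R] [Algebra A R] [FaithfulSMul A R] [Module.Finite A R] {d : ℕ}

/-- A prime of S minimal over x and lying over p is associated to xS. As S is a second syzygy, its
contraction to A is associated to a principal ideal (a) with a a nonzero multiple of x. A/(a) has
depth at least d - 1 if d > 0, which bounds the dimension from below. -/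
theorem le_ringKrullDim_quotient_succ_of_mem_minimalPrimes
    (hA : (⊥ : Ideal A).DepthGE d) {x : R} (hx0 : x ≠ 0) {p : Ideal R}
    (hp : p ∈ (Ideal.span {x}).minimalPrimes) : d ≤ ringKrullDim (R ⧸ p) + 1 := by
  obtain ⟨S, hS, n, t, i, φ, hi, hφ⟩ := exists_subalgebra_exact A R
  have := hp.1.1
  have : Module.Finite R S := .of_restrictScalars_finite A R S
  have hinj : Function.Injective (algebraMap R S) := fun a b h =>
    IsFractionRing.injective R (FractionRing R) (congrArg Subtype.val h)
  have : FaithfulSMul R S := (faithfulSMul_iff_algebraMap_injective R S).mpr hinj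
  have : FaithfulSMul A S := .trans A R S
  have : IsNoetherianRing S := .of_finite A S
  obtain ⟨P, -, hP, hPp⟩ := Ideal.exists_ideal_over_prime_of_isIntegral (S := S) p ⊥ (by
    rw [← RingHom.ker_eq_comap_bot, (RingHom.injective_iff_ker_eq_bot _).mp hinj]
    exact bot_le)
  have hxP : Ideal.span {algebraMap R S x} ≤ P := by
    rw [Ideal.span_singleton_le_iff_mem, ← Ideal.mem_comap, hPp]
    exact hp.1.2 (Ideal.mem_span_singleton_self x)
  obtain ⟨P', hP', hPP'⟩ := Ideal.exists_minimalPrimes_le hxP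
  have := hP'.1.1
  have hP'p : P'.comap (algebraMap R S) = p := by
    refine le_antisymm (hPp ▸ Ideal.comap_mono hPP') (hp.2 ⟨inferInstance, ?_⟩
      (hPp ▸ Ideal.comap_mono hPP'))
    rw [Ideal.span_singleton_le_iff_mem]
    exact hP'.1.2 (Ideal.mem_span_singleton_self _)
  obtain ⟨-, z, hz⟩ := Ideal.isAssociatedTo_of_mem_minimalPrimes hP'
  have hxS : algebraMap R S x ≠ 0 := (map_ne_zero_iff _ hinj).mpr hx0
  obtain ⟨a, ha0, x', hax⟩ := (Algebra.IsAlgebraic.isAlgebraic (R := A)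
    (algebraMap R S x)).exists_nonzero_dvd (mem_nonZeroDivisors_of_ne_zero hxS)
  have hcomap : p.comap (algebraMap A R) = P'.comap (algebraMap A S) := by
    rw [← hP'p, Ideal.comap_comap, ← IsScalarTower.algebraMap_eq]
  -- Multiplying by x' turns divisibility by x into divisibility by a = x x'. For elements of S this
  -- can be tested on coordinates in A^n, since A^t is torsion-free.
  have hmem : ∀ r : A, r ∈ P'.comap (algebraMap A S) ↔
      ∀ j, r * i (x' * z) j ∈ Ideal.span {a} := fun r => by
    rw [Ideal.mem_comap, hz, Ideal.mem_span_singleton]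
    constructor
    · rintro ⟨s, hs⟩ j
      rw [Ideal.mem_span_singleton]
      refine ⟨i s j, ?_⟩
      have : r • (x' * z) = a • s := by
        rw [Algebra.smul_def, Algebra.smul_def, hax]
        linear_combination x' * hs
      have := congrFun (congrArg i this) j
      rwa [map_smul, map_smul] at this
    · intro h
      choose c hc using fun j => Ideal.mem_span_singleton.mp (h j)
      have h1 : i (r • (x' * z)) = a • c := by
        rw [map_smul]
        exact funext hc
      have h2 : φ c = 0 := by
        have := hφ.apply_apply_eq_zero (r • (x' * z))
        rw [h1, map_smul] at this
        exact (smul_eq_zero.mp this).resolve_left ha0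
      obtain ⟨s, rfl⟩ := (hφ c).mp h2
      rw [← map_smul] at h1
      have h3 := hi h1
      rw [Algebra.smul_def, Algebra.smul_def, hax] at h3
      have hx' : x' ≠ 0 := by
        rintro rfl
        rw [mul_zero, map_eq_zero_iff _ (FaithfulSMul.algebraMap_injective A S)] at hax
        exact ha0 hax
      exact ⟨s, mul_left_cancel₀ hx' (by linear_combination h3)⟩
  set q := P'.comap (algebraMap A S) with hq
  have haq : a ∈ q := by
    rw [hq, Ideal.mem_comap, hax]
    exact P'.mul_mem_right _ (hP'.1.2 (Ideal.mem_span_singleton_self _))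
  -- q is a finite intersection of ideals (a : c_j); being prime, it equals one of them.
  have hassoc : (⊥ ⊔ Ideal.span {a}).IsAssociatedTo q := by
    rw [bot_sup_eq]
    refine ⟨inferInstance, ?_⟩
    let f : Fin n → Ideal A := fun j =>
      Submodule.comap (LinearMap.mulRight A (i (x' * z) j)) (Ideal.span {a})
    have : Finset.univ.inf f ≤ q := fun r hr => by
      rw [hmem]
      exact fun j => Finset.inf_le (f := f) (Finset.mem_univ j) hr
    obtain ⟨j, -, hj⟩ := (Ideal.IsPrime.inf_le' inferInstance).mp this
    exact ⟨_, fun r => ⟨fun hr => (hmem r).mp hr j, fun hr => hj hr⟩⟩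
  have hdim : ringKrullDim (A ⧸ q) = ringKrullDim (R ⧸ p) := by
    rw [← hcomap, ringKrullDim_quotient_comap]
  rw [← hdim]
  obtain _ | d := d
  · have := hassoc.1
    exact (ringKrullDim_nonneg_of_nontrivial (R := A ⧸ q)).trans
      (le_add_of_nonneg_right zero_le_one)
  · rw [Nat.cast_add, Nat.cast_one]
    gcongr
    refine (hA.sup_span_singleton (le_maximalIdeal hassoc.1.ne_top haq) ?_).natCast_le_ringKrullDim
      hassoc
    intro r hr
    rw [Ideal.mem_bot] at hr ⊢
    exact (mul_eq_zero.mp hr).resolve_left ha0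

theorem false_of_separated [IsLocalRing R] [IsNoetherianRing R]
    [IsAdicComplete (maximalIdeal R) R] (hdim : ringKrullDim R = d)
    (hA : (⊥ : Ideal A).DepthGE d) {x : R} (hx0 : x ≠ 0) {I J : Ideal R} {e : ℕ}
    (hIJ : (I * J) ^ e ≤ Ideal.span {x})
    (hdis : ∀ P : Ideal R, P.IsPrime → I ⊔ J ≤ P → ringKrullDim (R ⧸ P) + 3 ≤ d)
    {p q : Ideal R} (hp : p.IsPrime) (hq : q.IsPrime) (hIp : I ≤ p) (hJq : J ≤ q) (hxp : x ∈ p)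
    (hxq : x ∈ q) (hdp : d ≤ ringKrullDim (R ⧸ p) + 1) (hdq : d ≤ ringKrullDim (R ⧸ q) + 1) :
    False := by
  classical
  have hdimA : ringKrullDim A = d := by
    rw [← hdim]
    exact (RingHom.IsIntegral.ringKrullDim_eq (f := algebraMap A R)
      (algebraMap_isIntegral_iff.mpr inferInstance) (FaithfulSMul.algebraMap_injective A R)).symm
  have hIJm : I ⊔ J ≤ maximalIdeal R := sup_le (hIp.trans (le_maximalIdeal hp.ne_top))
    (hJq.trans (le_maximalIdeal hq.ne_top))
  have hcast : ∀ P : Ideal R, P.IsPrime → ∃ k : ℕ, ringKrullDim (R ⧸ P) = k := fun P hP =>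
    exists_natCast_eq_of_le ringKrullDim_nonneg_of_nontrivial
      (hdim ▸ ringKrullDim_quotient_le P)
  obtain ⟨k, rfl⟩ : ∃ k, d = k + 3 := by
    obtain ⟨k, hk⟩ := hcast (maximalIdeal R) inferInstance
    have := hdis _ inferInstance hIJm
    rw [hk] at this
    have : k + 3 ≤ d := by exact_mod_cast this
    exact ⟨d - 3, by omega⟩
  set c := (I ⊔ J).comap (algebraMap A R) with hc
  have hcm : c ≤ maximalIdeal A := by
    refine le_maximalIdeal fun h => (maximalIdeal.isMaximal R).ne_top (top_le_iff.mp ?_)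
    rw [hc, Ideal.comap_eq_top_iff] at h
    exact h ▸ hIJm
  -- No prime of A of dimension at least d - 2 = k + 1 contains c, by lying over. While the depth is
  -- at least k + 1, c therefore contains a regular element, which allows three choices.
  have hcP : ∀ P : Ideal A, P.IsPrime → ((k + 1 : ℕ) : WithBot ℕ∞) ≤ ringKrullDim (A ⧸ P) →
      ¬ c ≤ P := fun P hP hPk hcP => by
    obtain ⟨Q, hQ, hQp, rfl⟩ := Ideal.exists_ideal_over_prime_of_isIntegral P (I ⊔ J) hcP
    obtain ⟨l, hl⟩ := hcast Q hQp
    have h1 := hdis Q hQp hQ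
    rw [ringKrullDim_quotient_comap, hl] at hPk
    rw [hl] at h1
    have h1' : l + 3 ≤ k + 3 := by exact_mod_cast h1
    have h2' : k + 1 ≤ l := by exact_mod_cast hPk
    omega
  have hstep : ∀ (b : Ideal A) (m : ℕ), b.DepthGE m → k + 1 ≤ m → ∃ t ∈ c, b.IsRegularMod t :=
    fun b m hb hm => by
      obtain ⟨t, htc, ht⟩ := Ideal.exists_isRegularMod c {b} fun b' hb' P hP => by
        rw [Finset.mem_singleton] at hb'
        subst hb'
        exact hcP P hP.1 ((Nat.cast_le.mpr hm).trans (hb.natCast_le_ringKrullDim hP))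
      exact ⟨t, htc, ht b (Finset.mem_singleton_self b)⟩
  obtain ⟨a0, ha0c, ha0⟩ := hstep ⊥ _ hA (by omega)
  have hA1 := hA.sup_span_singleton (hcm ha0c) ha0
  obtain ⟨a1, ha1c, ha1⟩ := hstep _ _ hA1 (by omega)
  have hA2 := hA1.sup_span_singleton (hcm ha1c) ha1
  obtain ⟨a2, ha2c, ha2⟩ := hstep _ _ hA2 (by omega)
  have ha : IsRegularTriple ![a0, a1, a2] := ⟨ha0, ha1, ha2⟩
  have hac : ∀ j, ![a0, a1, a2] j ∈ c := fun j => by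
    fin_cases j
    exacts [ha0c, ha1c, ha2c]
  -- The regular elements a_0 and a_1 already cut the dimension by two, so a prime of dimension at
  -- least d - 1 cannot contain both.
  have hnot : ∀ P : Ideal R, P.IsPrime → ((k + 3 : ℕ) : WithBot ℕ∞) ≤ ringKrullDim (R ⧸ P) + 1 →
      ∃ j, algebraMap A R (![a0, a1, a2] j) ∉ P := fun P hP hPk => by
    by_contra! hcon
    have h0 : a0 ∈ P.comap (algebraMap A R) := hcon 0
    have h1 : a1 ∈ P.comap (algebraMap A R) := hcon 1
    have ha0' : a0 ∈ nonZeroDivisors A := mem_nonZeroDivisors_of_ne_zero fun h =>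
      one_ne_zero (α := A) (ha0 1 (by rw [h, zero_mul]; exact zero_mem _))
    have ha1' : Ideal.Quotient.mk (Ideal.span {a0}) a1 ∈
        nonZeroDivisors (A ⧸ Ideal.span {a0}) := by
      rw [mem_nonZeroDivisors_iff_right]
      intro r hr
      obtain ⟨r, rfl⟩ := Ideal.Quotient.mk_surjective r
      rw [← map_mul, Ideal.Quotient.eq_zero_iff_mem] at hr
      rw [Ideal.Quotient.eq_zero_iff_mem]
      have := ha1 r
      rw [bot_sup_eq] at this
      exact this (by rwa [mul_comm])
    have hle : Ideal.span {a0} ≤ P.comap (algebraMap A R) :=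
      (Ideal.span_singleton_le_iff_mem _).mpr h0
    have h2 := ringKrullDim_succ_le_of_surjective (Ideal.Quotient.factor hle)
      (Ideal.Quotient.factor_surjective hle) ha1' (by
        rw [Ideal.Quotient.factor_mk, Ideal.Quotient.eq_zero_iff_mem]
        exact h1)
    have h3 := ringKrullDim_quotient_succ_le_of_nonZeroDivisor ha0'
    obtain ⟨l, hl⟩ := hcast P hP
    rw [ringKrullDim_quotient_comap, hl] at h2
    rw [hl] at hPk
    have h4 : ((l : WithBot ℕ∞) + 1) + 1 ≤ ((k + 3 : ℕ) : WithBot ℕ∞) := by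
      rw [← hdimA]
      exact le_trans (by gcongr) h3
    have h4' : l + 1 + 1 ≤ k + 3 := by exact_mod_cast h4
    have hPk' : k + 3 ≤ l + 1 := by exact_mod_cast hPk
    omega
  obtain ⟨S, hS, n, t, i, φ, hi, hφ⟩ := exists_subalgebra_exact A R
  have : Module.Finite R S := .of_restrictScalars_finite A R S
  have hinj : Function.Injective (algebraMap R S) := fun a b h =>
    IsFractionRing.injective R (FractionRing R) (congrArg Subtype.val h)
  have hxS : algebraMap R S x ≠ 0 := (map_ne_zero_iff _ hinj).mpr hx0
  obtain ⟨f, hfJ, hfI⟩ := exists_separating_element hi hφ ha (mem_nonZeroDivisors_of_ne_zero hxS)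
    (I := I.map (algebraMap R S)) (J := J.map (algebraMap R S)) (e := e) (by
      rw [← Ideal.map_mul, ← Ideal.map_pow, ← Set.image_singleton, ← Ideal.map_span]
      exact Ideal.map_mono hIJ) (fun j => by
      rw [← Ideal.map_sup, IsScalarTower.algebraMap_apply A R S]
      exact Ideal.mem_map_of_mem _ (hac j))
  have hover : ∀ P : Ideal R, P.IsPrime → ∃ Q : Ideal S, Q.IsPrime ∧
      Q.comap (algebraMap R S) = P := fun P hP => by
    obtain ⟨Q, -, hQ, hQP⟩ := Ideal.exists_ideal_over_prime_of_isIntegral (S := S) P ⊥ (by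
      rw [← RingHom.ker_eq_comap_bot, (RingHom.injective_iff_ker_eq_bot _).mp hinj]
      exact bot_le)
    exact ⟨Q, hQ, hQP⟩
  obtain ⟨p', hp', rfl⟩ := hover p hp
  obtain ⟨q', hq', rfl⟩ := hover q hq
  have h1 : f ∈ q' := hfJ q' hq' (Ideal.map_le_iff_le_comap.mpr hJq) hxq (by
    obtain ⟨j, hj⟩ := hnot _ hq hdq
    exact ⟨j, by rwa [IsScalarTower.algebraMap_apply A R S]⟩)
  have h2 : 1 - f ∈ p' := hfI p' hp' (Ideal.map_le_iff_le_comap.mpr hIp) hxp (by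
    obtain ⟨j, hj⟩ := hnot _ hp hdp
    exact ⟨j, by rwa [IsScalarTower.algebraMap_apply A R S]⟩)
  rcases isUnit_or_isUnit_one_sub_of_finite R S f with h | h
  · exact hq'.ne_top (Ideal.eq_top_of_isUnit_mem _ h1 h)
  · exact hp'.ne_top (Ideal.eq_top_of_isUnit_mem _ h2 h)

end

/-! ### Connectedness of the graph. -/

theorem mainTheorem9 {R : Type*} [CommRing R] [IsDomain R] [IsNoetherianRing R] [IsLocalRing R]
    [IsAdicComplete (IsLocalRing.maximalIdeal R) R]
    (x : R) (hx : x ∈ IsLocalRing.maximalIdeal R) (hx0 : x ≠ 0) :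
    (hochsterHunekeGraph (R ⧸ Ideal.span {x})).Connected := by
  classical
  let B := R ⧸ Ideal.span {x}
  have : Nontrivial B := Ideal.Quotient.nontrivial_iff.mpr fun h =>
    (mem_maximalIdeal _).mp hx (Ideal.span_singleton_eq_top.mp h)
  obtain ⟨d, hd⟩ : ∃ d : ℕ, ringKrullDim R = d := by
    obtain ⟨d, hd⟩ := ENat.ne_top_iff_exists.mp
      (Ideal.height_ne_top (I := maximalIdeal R) Ideal.IsPrime.ne_top')
    exact ⟨d, by rw [← maximalIdeal_height_eq_ringKrullDim, ← hd]; rfl⟩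
  obtain ⟨A, hAfin, hAnoeth, hAloc, hAd⟩ := exists_subring_finite_depthGE R hd
  have hB : ringKrullDim B + 1 = d := by
    rw [← hd]
    exact ringKrullDim_quotient_span_singleton_succ_eq_ringKrullDim_of_mem_nonZeroDivisors
      (mem_nonZeroDivisors_of_ne_zero hx0) hx
  obtain ⟨b, hb⟩ : ∃ b : ℕ, ringKrullDim B = b :=
    exists_natCast_eq_of_le ringKrullDim_nonneg_of_nontrivial (hd ▸ ringKrullDim_quotient_le _)
  have hbd : b + 1 = d := by
    rw [hb] at hB
    exact_mod_cast hB
  let π : R →+* B := Ideal.Quotient.mk (Ideal.span {x})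
  have hπ : Function.Surjective π := Ideal.Quotient.mk_surjective
  have hπx : ∀ P : Ideal B, x ∈ P.comap π := fun P => by
    rw [Ideal.mem_comap, Ideal.Quotient.eq_zero_iff_mem.mpr (Ideal.mem_span_singleton_self x)]
    exact zero_mem _
  have hdimq : ∀ P : Ideal B, ringKrullDim (R ⧸ P.comap π) = ringKrullDim (B ⧸ P) := fun P =>
    by
    have hker : RingHom.ker ((Ideal.Quotient.mk P).comp π) = P.comap π := by
      rw [← RingHom.comap_ker, Ideal.mk_ker]
    rw [← hker]
    exact ringKrullDim_eq_of_ringEquiv (RingHom.quotientKerEquivOfSurjective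
      (Ideal.Quotient.mk_surjective.comp hπ))
  have hmin : ∀ P ∈ minimalPrimes B, P.comap π ∈ (Ideal.span {x}).minimalPrimes := fun P hP => by
    rw [Ideal.minimalPrimes_eq_comap]
    exact ⟨P, hP, rfl⟩
  have hdimp : ∀ P ∈ minimalPrimes B, d ≤ ringKrullDim (R ⧸ P.comap π) + 1 := fun P hP =>
    le_ringKrullDim_quotient_succ_of_mem_minimalPrimes hAd hx0 (hmin P hP)
  -- Every minimal prime is a vertex, so s and its complement together account for all components of
  -- x = 0.
  have hvert : ∀ P ∈ minimalPrimes B, ringKrullDim (B ⧸ P) = ringKrullDim B := fun P hP => by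
    refine le_antisymm (ringKrullDim_quotient_le _) ?_
    have h1 := hdimp P hP
    rw [hdimq] at h1
    have := hP.1.1
    obtain ⟨l, hl⟩ : ∃ l : ℕ, ringKrullDim (B ⧸ P) = l :=
      exists_natCast_eq_of_le ringKrullDim_nonneg_of_nontrivial ((ringKrullDim_quotient_le _).trans_eq hb)
    rw [hl] at h1 ⊢
    rw [hb]
    have h1' : d ≤ l + 1 := by exact_mod_cast h1
    have : b ≤ l := by omega
    exact_mod_cast this
  have hne : Nonempty (HochsterHunekeVertex B) := by
    obtain ⟨P, hP⟩ := Ideal.nonempty_minimalPrimes (I := (⊥ : Ideal B)) bot_ne_top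
    exact ⟨⟨P, hP, hvert P hP⟩⟩
  have hfin : Finite (HochsterHunekeVertex B) := by
    have := (Ideal.finite_minimalPrimes_of_isNoetherianRing B ⊥).to_subtype
    exact Finite.of_injective (fun v : HochsterHunekeVertex B =>
      (⟨v.1, v.2.1⟩ : (⊥ : Ideal B).minimalPrimes)) fun v w h => Subtype.ext (Subtype.mk.inj h)
  have := Fintype.ofFinite (HochsterHunekeVertex B)
  refine (SimpleGraph.connected_iff _).mpr ⟨fun u v => ?_, hne⟩
  by_contra huv
  let Γ := hochsterHunekeGraph B
  let s : Finset (HochsterHunekeVertex B) := Finset.univ.filter fun w => Γ.Reachable u w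
  let I : Ideal R := s.inf fun w => w.1.comap π
  let J : Ideal R := sᶜ.inf fun w => w.1.comap π
  have hus : u ∈ s := Finset.mem_filter.mpr ⟨Finset.mem_univ _, SimpleGraph.Reachable.refl u⟩
  have hvs : v ∈ sᶜ := by
    rw [Finset.mem_compl, Finset.mem_filter]
    exact fun h => huv h.2
  have hIJ : I * J ≤ (Ideal.span {x}).radical := by
    rw [Ideal.radical_eq_sInf]
    refine le_sInf fun P ⟨hP, hPp⟩ => ?_
    obtain ⟨p, hp, hpP⟩ := Ideal.exists_minimalPrimes_le hP
    rw [Ideal.minimalPrimes_eq_comap] at hp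
    obtain ⟨p, hp, rfl⟩ := hp
    let w : HochsterHunekeVertex B := ⟨p, hp, hvert p hp⟩
    refine le_trans ?_ hpP
    by_cases hw : w ∈ s
    · exact Ideal.mul_le_left.trans (Finset.inf_le (f := fun w => w.1.comap π) hw)
    · exact Ideal.mul_le_right.trans
        (Finset.inf_le (f := fun w => w.1.comap π) (Finset.mem_compl.mpr hw))
  obtain ⟨e, he⟩ := Ideal.exists_pow_le_of_le_radical_of_fg hIJ (IsNoetherian.noetherian _)
  have hprime : ∀ w : HochsterHunekeVertex B, (w.1.comap π).IsPrime := fun w =>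
    have := w.2.1.1.1
    Ideal.comap_isPrime _ _
  refine false_of_separated (p := u.1.comap π) (q := v.1.comap π) hd hAd hx0 he
    (fun P hP hIJP => ?_) (hprime u) (hprime v) (Finset.inf_le hus) (Finset.inf_le hvs) (hπx _)
    (hπx _) (hdimp _ u.2.1) (hdimp _ v.2.1)
  obtain ⟨w, hw, hwP⟩ := (Ideal.IsPrime.inf_le' hP).mp (le_sup_left.trans hIJP)
  obtain ⟨w', hw', hwP'⟩ := (Ideal.IsPrime.inf_le' hP).mp (le_sup_right.trans hIJP)
  have hnadj : ¬ Γ.Adj w w' := fun h => by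
    rw [Finset.mem_compl, Finset.mem_filter] at hw'
    exact hw' ⟨Finset.mem_univ _, (Finset.mem_filter.mp hw).2.trans h.reachable⟩
  have hww' : w ≠ w' := by
    rintro rfl
    exact (Finset.mem_compl.mp hw') hw
  have hQP : (P.map π).comap π = P := by
    rw [Ideal.comap_map_of_surjective π hπ, sup_eq_left, ← RingHom.ker_eq_comap_bot, Ideal.mk_ker,
      Ideal.span_singleton_le_iff_mem]
    exact hwP (hπx _)
  have hker : RingHom.ker π ≤ P := by
    rw [Ideal.mk_ker, Ideal.span_singleton_le_iff_mem]
    exact hwP (hπx _)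
  have hQ : (P.map π).IsPrime := Ideal.map_isPrime_of_surjective hπ hker
  have hwQ : w.1 + w'.1 ≤ P.map π := by
    rw [← hQP] at hwP hwP'
    exact sup_le ((Ideal.comap_le_comap_iff_of_surjective π hπ _ _).mp hwP)
      ((Ideal.comap_le_comap_iff_of_surjective π hπ _ _).mp hwP')
  -- Height 0 would force the two distinct minimal primes to coincide, and height 1 would make them
  -- adjacent.
  have hht : 2 ≤ (P.map π).height := by
    refine le_trans ?_ (Ideal.height_mono hwQ)
    have h0 : (w.1 + w'.1).height ≠ 0 := fun h0 => by
      obtain ⟨P', hP', hle, hP'0⟩ := Ideal.exists_isPrime_height_eq (n := 0) h0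
      have hP'min := Ideal.height_eq_zero_iff.mp hP'0
      refine hww' (Subtype.ext ?_)
      rw [le_antisymm (le_sup_left.trans hle) (hP'min.2 w.2.1.1 (le_sup_left.trans hle)),
        le_antisymm (le_sup_right.trans hle) (hP'min.2 w'.2.1.1 (le_sup_right.trans hle))]
    have h1 : (w.1 + w'.1).height ≠ 1 := fun h => hnadj ⟨hww', h⟩
    generalize (w.1 + w'.1).height = n at h0 h1
    induction n using ENat.recTopCoe with
    | top => exact le_top
    | coe n =>
      have h0' : n ≠ 0 := by exact_mod_cast h0
      have h1' : n ≠ 1 := by exact_mod_cast h1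
      have : 2 ≤ n := by omega
      exact_mod_cast this
  have := ringKrullDim_quotient_add_two_le_of_two_le_height hht
  rw [← hQP, hdimq]
  calc ringKrullDim (B ⧸ P.map π) + 3 = ringKrullDim (B ⧸ P.map π) + 2 + 1 := by rw [add_assoc]; norm_num
    _ ≤ ringKrullDim B + 1 := by gcongr
    _ = d := hB
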